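/- Let $\mathbb P^*$ be the set of finite words of positive integers (integer compositions, including the empty one), ordered by $u\le w$ iff $w$ has a subword $w(i_1)\cdots w(i_l)$, $l=|u|$, with $u(j)\le w(i_j)$ for all $j$. **Embeddings.** An expansion of a word is obtained by inserting zeros. An embedding of $u$ into a word or expansion $\zeta$ is an expansion $\eta$ of $u$ of the same length as $\zeta$ with $\eta(i)\le\zeta(i)$ for all $i$. A run is a maximal block of equal consecutive letters (in an expansion, zeros are ignored). The embedding $\eta$ is *normal* if (1) each $\eta(i)$ is $\zeta(i)$, $\zeta(i)-1$ or $0$; (2) $\eta$ is nonzero at every position of a run of $1$'s except possibly the first, and at the first position of every run of $k$'s with $k\ge2$. For an embedding $\eta_u$ of $u$ into $w$ put $$d(\eta_u)=\#\{i:\eta_u(i)=w(i)-1\},\qquad D(\eta_u)=\#\{i:\eta_u(i)=0,\ w(i)\ge2\}.$$ **Chains.** Let $u<w$. A maximal chain $C:\ w=v_0\to v_1\to\cdots\to v_d=u$ of $[u,w]$ (each $v_j$ covers $v_{j+1}$) determines embeddings into $w$: $\eta_{v_0}=w$, and $\eta_{v_{j+1}}$ is the unique normal embedding of $v_{j+1}$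 into $\eta_{v_j}$. We say that $C$ ends at $\eta_{v_d}$. The label of the edge $v_j\to v_{j+1}$ is the position at which $\eta_{v_j}$ is decreased, and $l(C)$ is the sequence of labels. Order the maximal chains lexicographically by $l(C)$ (a PL-order), and call $C$ weakly decreasing if $l(C)$ is. "First" in a chain refers to reading it from $w$ down to $u$. **The Babson–Hersh matching.** Regard $C$ as the set $\{v_1,\dots,v_{d-1}\}$. A subset $\sigma\subseteq C$ (possibly empty) is a *new face* if it lies in no earlier chain. A nonempty interval $I=\{v_{i+1},\dots,v_{j-1}\}$ of $C$ is *skipped* if $C\setminus I\subseteq C'$ for some $C'<C$; $\mathcal I(C)$ is the set of inclusion-minimal skipped intervals. The $J$-intervals $\mathcal J(C)=\{J_1,J_2,\dots\}$ are obtained from $\mathcal I(C)$ by repeatedly taking the first interval of the family, subtracting it from the others, and keeping only the nonempty inclusion-minimal differences, until nothing is left. Let $x_i$ be the first element of $J_i$ and $\sigma_C=\{x_1,x_2,\dots\}$. New faces $\sigma$ of $C$ are matched as follows. - If $\bigcup\mathcal I(C)\ne C$: $\sigma\leftrightarrow\sigma\mathbin\Delta\{x_0\}$, where $x_0$ is the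 first vertex of $C\setminus\bigcup\mathcal I(C)$. - If $\bigcup\mathcal J(C)=C$: for $\sigma\neq\sigma_C$, $\sigma\leftrightarrow\sigma\mathbin\Delta\{x_i\}$, where $i$ is least with $\sigma\cap J_i\ne\{x_i\}$. - If $\bigcup\mathcal I(C)=C\neq\bigcup\mathcal J(C)$: faces with $\sigma\cap\bigcup\mathcal J(C)\ne\sigma_C$ are matched as in the second case, the others by $\sigma\leftrightarrow\sigma\mathbin\Delta\{x_0\}$ with $x_0$ the first vertex of $C\setminus\bigcup\mathcal J(C)$. The chain $C$ is *critical* if some new face of $C$ is unmatched. **Theorem.** Let $u<w$ in $\mathbb P^*$. 1. For every normal embedding $\eta_u$ of $u$ into $w$ there is a unique weakly decreasing maximal chain of $[u,w]$ ending at $\eta_u$, and sending $\eta_u$ to this chain is a bijection from the normal embeddings of $u$ into $w$ to the critical chains of $[u,w]$. 2. If $C$ is critical and ends at $\eta_u$, then $\mathcal I(C)=\mathcal J(C)$ and $\#\mathcal I(C)=d(\eta_u)+2D(\eta_u)-1$. -/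

import Mathlib

/-! # The composition poset, its labelled maximal chains, and the Babson–Hersh matching -/

/-! ## The Babson–Hersh matching for an ordering of the maximal chains of an interval

Chains are read from the top `w` down to the bottom `u`, so within a chain the *first* element of a
set of vertices is its greatest element in the poset. -/

namespace BabsonHersh

/-- A maximal chain `w = v₀ ⋗ v₁ ⋗ ⋯ ⋗ v_d = u` of the interval `[u, w]`, listed from the top. -/
@[ext]
structure MaxChain {P : Type*} [PartialOrder P] (u w : P) where
  /-- the vertices, listed from the top down -/
  verts : List P
  head_eq : verts.head? = some w
  last_eq : verts.getLast? = some u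
  covers : verts.IsChain (fun x y => y ⋖ x)

namespace MaxChain

variable {P : Type*} [PartialOrder P] {u w : P}

open Classical in
/-- The open interval `C(x, y)` of the chain `C`: its vertices strictly below `x` and strictly
above `y`. -/
noncomputable def openInterval (C : MaxChain u w) (x y : P) : Finset P :=
  C.verts.toFinset.filter (fun v => y < v ∧ v < x)

/-- `C` as a facet of the order complex of the open interval `(u, w)`: the end points are removed. -/
noncomputable def interior (C : MaxChain u w) : Finset P := C.openInterval w u

/-- A face `σ` of `C` is new if it is contained in no chain that comes before `C`.  The empty face is
included.  Here and below `prec C' C` means that `C'` comes before `C`. -/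
def IsNewFace (prec : MaxChain u w → MaxChain u w → Prop) (C : MaxChain u w) (σ : Finset P) : Prop :=
  σ ⊆ C.interior ∧ ∀ C', prec C' C → ¬ σ ⊆ C'.interior

/-- A skipped interval of `C`: a nonempty open interval `I` of `C` such that `C - I` is contained
in a chain that comes before `C`. -/
def IsSkipped (prec : MaxChain u w → MaxChain u w → Prop) (C : MaxChain u w) (I : Finset P) : Prop :=
  I.Nonempty ∧ (∃ x ∈ C.verts, ∃ y ∈ C.verts, I = C.openInterval x y) ∧
    ∃ C', prec C' C ∧ ∀ v ∈ C.verts, v ∉ I → v ∈ C'.verts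

open Classical in
/-- The set `𝓘(C)` of minimal skipped intervals (MSIs) of `C`: those skipped intervals that do not
strictly contain another one. -/
noncomputable def msi (prec : MaxChain u w → MaxChain u w → Prop) (C : MaxChain u w) :
    Finset (Finset P) :=
  C.interior.powerset.filter (fun I => Minimal (C.IsSkipped prec) I)

end MaxChain

open Classical in
/-- Cut `J` out of the other members of `F`, and keep the nonempty sets `K - J` that are minimal
under inclusion. -/
noncomputable def truncate {P : Type*} (F : Finset (Finset P)) (J : Finset P) : Finset (Finset P) :=
  let G := ((F.erase J).image (fun K => K \ J)).filter (fun K => K.Nonempty)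
  G.filter (fun K => Minimal (fun S => S ∈ G) K)

theorem card_truncate_lt {P : Type*} {F : Finset (Finset P)} {J : Finset P} (h : J ∈ F) :
    (truncate F J).card < F.card := by
  classical
  refine lt_of_le_of_lt ((Finset.card_filter_le _ _).trans ((Finset.card_filter_le _ _).trans
    (Finset.card_image_le))) ?_
  convert Finset.card_erase_lt_of_mem h

section JIntervals

variable {P : Type*} [PartialOrder P]

/-- `J` is the member of the family `F` that is encountered first when reading the chain from the
top. -/
def IsFirstMember (F : Finset (Finset P)) (J : Finset P) : Prop :=
  J ∈ F ∧ ∃ x ∈ J, ∀ K ∈ F, ∀ y ∈ K, y ≤ x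

open Classical in
/-- The process that makes a family of intervals of a chain disjoint: take the first member `J`,
truncate the others by `J`, throw out those that are not minimal, and repeat with what remains,
until nothing is left. -/
noncomputable def disjointify (F : Finset (Finset P)) : List (Finset P) :=
  if h : ∃ J, IsFirstMember F J then h.choose :: disjointify (truncate F h.choose) else []
termination_by F.card
decreasing_by exact card_truncate_lt h.choose_spec.1

/-- `x` is the first element of the first interval `J` of the list with `σ ∩ J ≠ {first J}`. -/
def IsPivot [DecidableEq P] : List (Finset P) → Finset P → P → Prop
  | [], _, _ => False
  | J :: L, σ, x => (IsGreatest (J : Set P) x ∧ σ ∩ J ≠ {x}) ∨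
      ((∃ y, IsGreatest (J : Set P) y ∧ σ ∩ J = {y}) ∧ IsPivot L σ x)

end JIntervals

namespace MaxChain

variable {P : Type*} [PartialOrder P] {u w : P}

/-- The sequence `J₁, J₂, …, J_r` of `J`-intervals of `C`. -/
noncomputable def jSeq (prec : MaxChain u w → MaxChain u w → Prop) (C : MaxChain u w) :
    List (Finset P) :=
  disjointify (C.msi prec)

open Classical in
/-- The set `𝓙(C)` of `J`-intervals of `C`. -/
noncomputable def jIntervals (prec : MaxChain u w → MaxChain u w → Prop) (C : MaxChain u w) :
    Finset (Finset P) :=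
  (C.jSeq prec).toFinset

open Classical in
/-- The union of a family of intervals. -/
noncomputable def unionOf (K : Finset (Finset P)) : Finset P := K.biUnion id

/-- The family `K` of intervals covers `C` (seen as a subset of the open interval `(u, w)`). -/
def CoveredBy (C : MaxChain u w) (K : Finset (Finset P)) : Prop := unionOf K = C.interior

open Classical in
/-- The face `σ_C` that consists of the first elements of the `J`-intervals. -/
noncomputable def sigma (prec : MaxChain u w → MaxChain u w → Prop) (C : MaxChain u w) : Finset P :=
  C.interior.filter (fun x => ∃ J ∈ C.jIntervals prec, IsGreatest (J : Set P) x)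

open Classical in
/-- The matching sends the new face `σ` of `C` to `σ ∆ {x}`, where the vertex `x` is as follows.
* If `𝓘(C)` does not cover `C`: the first vertex of `C - ⋃ 𝓘(C)`.
* If `𝓙(C)` covers `C` and `σ ≠ σ_C`: the first element `x_i` of the `J`-interval `J_i` of
  smallest index with `σ ∩ J_i ≠ {x_i}`.
* If `𝓘(C)` covers `C` but `𝓙(C)` does not: `x_i` as before if the restriction of `σ` to `⋃ 𝓙(C)`
  is not `σ_C`, and the first vertex of `C - ⋃ 𝓙(C)` otherwise. -/
def IsToggle (prec : MaxChain u w → MaxChain u w → Prop) (C : MaxChain u w) (σ : Finset P) (x : P) :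
    Prop :=
  (¬ C.CoveredBy (C.msi prec) ∧
    IsGreatest ((C.interior \ unionOf (C.msi prec) : Finset P) : Set P) x) ∨
  (C.CoveredBy (C.msi prec) ∧ C.CoveredBy (C.jIntervals prec) ∧ σ ≠ C.sigma prec ∧
    IsPivot (C.jSeq prec) σ x) ∨
  (C.CoveredBy (C.msi prec) ∧ ¬ C.CoveredBy (C.jIntervals prec) ∧
    ((σ ∩ unionOf (C.jIntervals prec) ≠ C.sigma prec ∧ IsPivot (C.jSeq prec) σ x) ∨
     (σ ∩ unionOf (C.jIntervals prec) = C.sigma prec ∧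
      IsGreatest ((C.interior \ unionOf (C.jIntervals prec) : Finset P) : Set P) x)))

open Classical in
/-- The matching on the new faces of `C`: `σ` and `τ` are matched if each is sent to the other. -/
def Matched (prec : MaxChain u w → MaxChain u w → Prop) (C : MaxChain u w) (σ τ : Finset P) : Prop :=
  C.IsNewFace prec σ ∧ C.IsNewFace prec τ ∧
    ∃ x, C.IsToggle prec σ x ∧ C.IsToggle prec τ x ∧ τ = symmDiff σ {x}

/-- A maximal chain is critical if it contributes a critical cell, i.e. a new face that the
matching leaves unmatched. -/
def IsCritical (prec : MaxChain u w → MaxChain u w → Prop) (C : MaxChain u w) : Prop :=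
  ∃ σ, C.IsNewFace prec σ ∧ ∀ τ, ¬ C.Matched prec σ τ

end MaxChain

end BabsonHersh

/-! ## The composition poset `ℙ*` -/

namespace CompositionPoset

open BabsonHersh

/-- Elements of `ℙ*`: finite words of positive integers. -/
@[ext]
structure PWord where
  /-- the letters -/
  parts : List ℕ+

/-- `u ≤ w` if `w` has a subword of length `|u|` that dominates `u` letter by letter. -/
instance : PartialOrder PWord where
  le u w := List.SublistForall₂ (· ≤ ·) u.parts w.parts
  le_refl u := refl_of (List.SublistForall₂ (· ≤ ·)) u.parts
  le_trans _ _ _ h₁ h₂ := trans_of (List.SublistForall₂ (· ≤ ·)) h₁ h₂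
  le_antisymm u w h₁ h₂ := by
    obtain ⟨a, ha, ha'⟩ := List.sublistForall₂_iff.1 h₁
    obtain ⟨b, hb, hb'⟩ := List.sublistForall₂_iff.1 h₂
    have e₁ := ha.length_eq
    have e₂ := hb.length_eq
    have l₁ := ha'.length_le
    have l₂ := hb'.length_le
    have hae := ha'.eq_of_length (by omega)
    have hbe := hb'.eq_of_length (by omega)
    subst hae hbe
    refine PWord.ext ?_
    rw [List.forall₂_iff_get] at ha hb
    exact List.ext_get ha.1 fun i hi hj => le_antisymm (ha.2 i hi hj) (hb.2 i hj hi)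

/-- The word `w` as a sequence `w(1), …, w(|w|)` of natural numbers (positions are numbered from `0`).
Expansions of words, in which `0` is allowed as a letter, are sequences `Fin n → ℕ`. -/
def PWord.toSeq (w : PWord) : Fin w.parts.length → ℕ := fun i => (w.parts.get i : ℕ)

/-- `η` is an expansion of `u`: its nonzero letters, in order, spell `u`. -/
def IsExpansion {n : ℕ} (u : PWord) (η : Fin n → ℕ) : Prop :=
  (List.ofFn η).filter (fun a => a ≠ 0) = u.parts.map (fun a : ℕ+ => (a : ℕ))

/-- `η` is an embedding of `u` into `ζ`, where `ζ` is a word or an expansion of a word. -/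
def IsEmbedding {n : ℕ} (u : PWord) (ζ η : Fin n → ℕ) : Prop :=
  IsExpansion u η ∧ ∀ i, η i ≤ ζ i

/-- Position `i` is the first one of its run in `ζ`: the nearest nonzero letter on the left of
position `i`, if there is one, differs from the letter at `i`.  Zeros of an expansion are ignored,
as they are not letters of the word that is expanded; if `ζ` has no zeros, this says that `i` is
the left end `r` of a maximal interval `[r, t]` of indices on which `ζ` is constant. -/
def IsRunStart {n : ℕ} (ζ : Fin n → ℕ) (i : Fin n) : Prop :=
  ∀ j, j < i → ζ j ≠ 0 → (∀ m, j < m → m < i → ζ m = 0) → ζ j ≠ ζ i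

/-- `η` is a normal embedding of `u` into `ζ`. -/
structure IsNormalEmbedding {n : ℕ} (u : PWord) (ζ η : Fin n → ℕ) : Prop where
  isEmbedding : IsEmbedding u ζ η
  /-- each letter is kept, decreased by one, or replaced by zero -/
  value : ∀ i, η i = ζ i ∨ η i + 1 = ζ i ∨ η i = 0
  /-- in a run of ones, all positions but the first are in the support -/
  run_one : ∀ i, ζ i = 1 → ¬ IsRunStart ζ i → η i ≠ 0
  /-- in a run of `k`s with `k ≥ 2`, the first position is in the support -/
  run_two_le : ∀ i, 2 ≤ ζ i → IsRunStart ζ i → η i ≠ 0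

/-- The normal embedding of `y` into the expansion `ζ` of a word that covers `y` (in that case there
is exactly one). -/
noncomputable def nextEmbedding {n : ℕ} (ζ : Fin n → ℕ) (y : PWord) : Fin n → ℕ :=
  Classical.epsilon fun η => IsNormalEmbedding y ζ η

/-- The position that is decreased in passing from `ζ` to `η`. -/
noncomputable def decreasedPosition {n : ℕ} (ζ η : Fin n → ℕ) : ℕ :=
  sInf {k : ℕ | ∃ h : k < n, η ⟨k, h⟩ < ζ ⟨k, h⟩}

/-- The labels of the edges of a descending chain that starts at the word with expansion `ζ` and
continues with the vertices in the list. -/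
noncomputable def labelsFrom {n : ℕ} (ζ : Fin n → ℕ) : List PWord → List ℕ
  | [] => []
  | v :: vs => decreasedPosition ζ (nextEmbedding ζ v) :: labelsFrom (nextEmbedding ζ v) vs

variable {u w : PWord}

/-- The label sequence `l(C)` of a maximal chain. -/
noncomputable def labels (C : MaxChain u w) : List ℕ := labelsFrom w.toSeq C.verts.tail

/-- The embedding `η_u` of `u` into `w` at which the chain `C` ends, obtained from `η_{v₀} = w` by
passing successively to the normal embedding of `v_{j+1}` into `η_{v_j}`. -/
noncomputable def endEmbedding (C : MaxChain u w) : Fin w.parts.length → ℕ :=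
  C.verts.tail.foldl nextEmbedding w.toSeq

/-- `C'` comes before `C`: the label sequence of `C'` is lexicographically smaller. -/
def Precedes (C' C : MaxChain u w) : Prop := List.Lex (· < ·) (labels C') (labels C)

/-- The label sequence of `C` is weakly decreasing. -/
def WeaklyDecreasing (C : MaxChain u w) : Prop := (labels C).Pairwise (· ≥ ·)

/-- The defect `d(η)`, the number of positions with `η(i) = w(i) - 1`. -/
def defect (w : PWord) (η : Fin w.parts.length → ℕ) : ℕ :=
  (Finset.univ.filter fun i => η i + 1 = w.toSeq i).card

/-- `D(η)`, the number of positions with `η(i) = 0` and `w(i) ≥ 2`. -/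
def bigDefect (w : PWord) (η : Fin w.parts.length → ℕ) : ℕ :=
  (Finset.univ.filter fun i => η i = 0 ∧ 2 ≤ w.toSeq i).card

end CompositionPoset

/-! Passing to a covered word decreases one letter of an expansion. It can always be taken at a
legal position: a letter at least `2`, or the first of a run of ones. Different legal positions give
different words (`Legal.eq_of_word_dec_eq`). Hence a maximal chain is the same thing as its label
sequence, and the vertex of index `j` has rank `w.rank - j`.

The core is the list of minimal skipped intervals (`mem_msi_iff`). They are of two kinds: a single
vertex at a strict descent of the labels, where the two decreases may be exchanged; and a `Block`,
where a letter `x ≥ 2` standing just after an equal letter is deleted in `x` consecutive steps,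
while lowering the left copy first would reach the same word. That there are no others is
`block_of_minimal_alt`. These intervals are pairwise disjoint, so they are already the
`J`-intervals, and a chain is critical exactly when they cover it (`isCritical_iff`).

Covering means that every interior vertex is a descent or lies inside a block of constant label.
This makes the labels weakly decreasing, and the block conditions translate into normality of the
final embedding; the argument also runs backwards. A weakly decreasing chain is determined by its
final embedding, which gives the bijection. Each of the `d + D` lowered positions has one run of
equal labels; the runs after the highest begin at descents, and `D` of the runs are blocks, so there
are `(d + D - 1) + D` intervals. -/

namespace CompositionPoset

open BabsonHersh

/-! ## Domination of words of natural numbers -/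

/-- `a` is dominated letter by letter by a subword of `b`. -/
abbrev Dom (a b : List ℕ) : Prop := List.SublistForall₂ (· ≤ ·) a b

theorem Dom.refl (a : List ℕ) : Dom a a := refl_of (List.SublistForall₂ (· ≤ ·)) a

theorem Dom.trans {a b c : List ℕ} (h : Dom a b) (h' : Dom b c) : Dom a c :=
  trans_of (List.SublistForall₂ (· ≤ ·)) h h'

theorem Dom.append {a b c d : List ℕ} (h : Dom a b) (h' : Dom c d) : Dom (a ++ c) (b ++ d) := by
  obtain ⟨l, hl, hs⟩ := List.sublistForall₂_iff.1 h
  obtain ⟨m, hm, hs'⟩ := List.sublistForall₂_iff.1 h'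
  exact List.sublistForall₂_iff.2 ⟨l ++ m, List.rel_append hl hm, hs.append hs'⟩

theorem Dom.reverse {a b : List ℕ} (h : Dom a b) : Dom a.reverse b.reverse := by
  obtain ⟨l, hl, hs⟩ := List.sublistForall₂_iff.1 h
  exact List.sublistForall₂_iff.2 ⟨l.reverse, List.forall₂_reverse_iff.2 hl, hs.reverse⟩

theorem dom_cons_cons {x y : ℕ} {a b : List ℕ} (h : Dom (y :: a) (x :: b)) :
    (y ≤ x ∧ Dom a b) ∨ Dom (y :: a) b := by
  cases h with
  | cons h₁ h₂ => exact .inl ⟨h₁, h₂⟩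
  | cons_right h => exact .inr h

theorem dom_concat {x y : ℕ} {a b : List ℕ} (h : Dom (a ++ [y]) (b ++ [x])) :
    (y ≤ x ∧ Dom a b) ∨ Dom (a ++ [y]) b := by
  have h' := h.reverse
  simp only [List.reverse_append, List.reverse_singleton, List.singleton_append] at h'
  rcases dom_cons_cons h' with ⟨h₁, h₂⟩ | h₁
  · exact .inl ⟨h₁, by simpa using h₂.reverse⟩
  · exact .inr (by simpa using h₁.reverse)

theorem dom_append_left (a b : List ℕ) : Dom a (a ++ b) := by
  simpa using (Dom.refl a).append (List.SublistForall₂.nil : Dom [] b)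

/-- If the last letter `y` is not matched with `x`, the whole of `a ++ [y]` already fits into `b`.
-/
theorem Dom.of_concat {x y : ℕ} {a b : List ℕ} (h : Dom (a ++ [y]) (b ++ [x])) : Dom a b := by
  rcases dom_concat h with h | h
  · exact h.2
  · exact (dom_append_left a [y]).trans h

theorem Dom.of_append_right {a b : List ℕ} (c : List ℕ) (h : Dom (a ++ c) (b ++ c)) : Dom a b := by
  induction c generalizing a b with
  | nil => simpa using h
  | cons x c ih =>
    have : Dom ((a ++ [x]) ++ c) ((b ++ [x]) ++ c) := by simpa using h
    exact (ih this).of_concat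

/-! ## Nonzero letters -/

/-- The nonzero letters of a sequence. -/
def nonzero (L : List ℕ) : List ℕ := L.filter fun a => a ≠ 0

theorem nonzero_append (L M : List ℕ) : nonzero (L ++ M) = nonzero L ++ nonzero M :=
  List.filter_append ..

theorem nonzero_cons_zero (L : List ℕ) : nonzero (0 :: L) = nonzero L := by simp [nonzero]

theorem nonzero_cons {a : ℕ} (h : a ≠ 0) (L : List ℕ) : nonzero (a :: L) = a :: nonzero L := by
  simp [nonzero, h]

theorem nonzero_singleton {a : ℕ} (h : a ≠ 0) : nonzero [a] = [a] := by simp [nonzero, h]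

theorem nonzero_singleton_zero : nonzero [0] = [] := by simp [nonzero]

theorem ne_zero_of_mem_nonzero {L : List ℕ} {a : ℕ} (h : a ∈ nonzero L) : a ≠ 0 := by
  simpa using (List.mem_filter.1 h).2

theorem sum_nonzero (L : List ℕ) : (nonzero L).sum = L.sum := by
  induction L with
  | nil => rfl
  | cons a L ih =>
    rcases eq_or_ne a 0 with rfl | h
    · simp [nonzero_cons_zero, ih]
    · simp [nonzero_cons h, ih]

theorem dom_nonzero {L M : List ℕ} (h : List.Forall₂ (· ≤ ·) L M) :
    Dom (nonzero L) (nonzero M) := by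
  induction h with
  | nil => exact .nil
  | @cons a b L M hab _ ih =>
    rcases eq_or_ne a 0 with rfl | ha
    · rw [nonzero_cons_zero]
      rcases eq_or_ne b 0 with rfl | hb
      · rwa [nonzero_cons_zero]
      · rw [nonzero_cons hb]; exact .cons_right ih
    · rw [nonzero_cons ha, nonzero_cons (show b ≠ 0 by omega)]
      exact .cons hab ih

/-- The subword order becomes the pointwise order once zeros are inserted at the skipped places;
`exists_of_le_word` rests on this. -/
theorem exists_forall₂_of_dom {L a : List ℕ} (h : Dom a (nonzero L)) (ha : ∀ x ∈ a, x ≠ 0) :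
    ∃ M, List.Forall₂ (· ≤ ·) M L ∧ nonzero M = a := by
  induction L generalizing a with
  | nil => cases h; exact ⟨[], .nil, rfl⟩
  | cons b L ih =>
    rcases eq_or_ne b 0 with rfl | hb
    · rw [nonzero_cons_zero] at h
      obtain ⟨M, hM, rfl⟩ := ih h ha
      exact ⟨0 :: M, .cons le_rfl hM, nonzero_cons_zero M⟩
    · rw [nonzero_cons hb] at h
      cases h with
      | nil =>
        obtain ⟨M, hM, hM'⟩ := ih (a := []) .nil (by simp)
        exact ⟨0 :: M, .cons (Nat.zero_le _) hM, by rw [nonzero_cons_zero, hM']⟩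
      | @cons x _ l _ h₁ h₂ =>
        obtain ⟨M, hM, hM'⟩ := ih h₂ (fun y hy => ha y (by simp [hy]))
        exact ⟨x :: M, .cons h₁ hM, by rw [nonzero_cons (ha x (by simp)), hM']⟩
      | cons_right h₂ =>
        obtain ⟨M, hM, hM'⟩ := ih h₂ ha
        exact ⟨0 :: M, .cons (Nat.zero_le _) hM, by rw [nonzero_cons_zero, hM']⟩

/-! ## Words -/

/-- The letters of a word as natural numbers. -/
def PWord.letters (u : PWord) : List ℕ := u.parts.map fun a : ℕ+ => (a : ℕ)

theorem PWord.letters_injective : Function.Injective PWord.letters := fun _ _ h =>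
  PWord.ext (List.map_injective_iff.2 PNat.coe_injective h)

theorem PWord.ne_zero_of_mem_letters {u : PWord} {x : ℕ} (h : x ∈ u.letters) : x ≠ 0 := by
  obtain ⟨a, -, rfl⟩ := List.mem_map.1 h
  exact a.ne_zero

theorem PWord.le_iff {u v : PWord} : u ≤ v ↔ Dom u.letters v.letters := by
  change List.SublistForall₂ _ _ _ ↔ _
  simp only [Dom, PWord.letters, List.sublistForall₂_map_left_iff,
    List.sublistForall₂_map_right_iff, PNat.coe_le_coe]

/-- The word that consists of the nonzero letters of a list. -/
def PWord.ofList (L : List ℕ) : PWord :=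
  ⟨L.filterMap fun a => if h : 0 < a then some ⟨a, h⟩ else none⟩

theorem PWord.letters_ofList (L : List ℕ) : (PWord.ofList L).letters = nonzero L := by
  induction L with
  | nil => rfl
  | cons a L ih =>
    simp only [PWord.letters, PWord.ofList] at ih ⊢
    rcases Nat.eq_zero_or_pos a with rfl | h
    · simpa [nonzero_cons_zero] using ih
    · rw [nonzero_cons h.ne', ← ih, List.filterMap_cons_some (b := ⟨a, h⟩) (by simp [h])]
      rfl

/-- The rank of a word, which is the sum of its letters. -/
def PWord.rank (u : PWord) : ℕ := u.letters.sum

variable {n : ℕ}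

/-- The word of which `ζ` is an expansion. -/
def word (ζ : Fin n → ℕ) : PWord := PWord.ofList (List.ofFn ζ)

theorem letters_word (ζ : Fin n → ℕ) : (word ζ).letters = nonzero (List.ofFn ζ) :=
  PWord.letters_ofList _

theorem isExpansion_iff {u : PWord} {ζ : Fin n → ℕ} : IsExpansion u ζ ↔ word ζ = u := by
  rw [← PWord.letters_injective.eq_iff, letters_word]; rfl

theorem word_toSeq (w : PWord) : word w.toSeq = w := by
  rw [← isExpansion_iff, IsExpansion]
  have h : List.ofFn w.toSeq = w.letters := by
    refine List.ext_getElem (by simp [PWord.letters]) fun i h₁ h₂ => ?_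
    simp [PWord.letters, PWord.toSeq]
  rw [h]
  exact List.filter_eq_self.2 fun a ha => by simpa using PWord.ne_zero_of_mem_letters ha

theorem rank_word (ζ : Fin n → ℕ) : (word ζ).rank = ∑ i, ζ i := by
  rw [PWord.rank, letters_word, sum_nonzero, List.sum_ofFn]

theorem word_mono {η ζ : Fin n → ℕ} (h : ∀ i, η i ≤ ζ i) : word η ≤ word ζ := by
  rw [PWord.le_iff, letters_word, letters_word]
  refine dom_nonzero (List.forall₂_iff_get.2 ⟨by simp, fun i h₁ h₂ => ?_⟩)
  simpa using h _

theorem exists_of_le_word {u : PWord} {ζ : Fin n → ℕ} (h : u ≤ word ζ) :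
    ∃ η : Fin n → ℕ, (∀ i, η i ≤ ζ i) ∧ word η = u := by
  rw [PWord.le_iff, letters_word] at h
  obtain ⟨M, hM, hM'⟩ := exists_forall₂_of_dom h fun x hx => PWord.ne_zero_of_mem_letters hx
  have hl : M.length = n := by simpa using hM.length_eq
  subst hl
  refine ⟨fun i => M[i], fun i => ?_, ?_⟩
  · have := (List.forall₂_iff_get.1 hM).2 i i.2 (by simp)
    simpa using this
  · rw [← PWord.letters_injective.eq_iff, letters_word, ← hM']
    congr 1
    exact List.ofFn_getElem

/-- Pointwise inequality with equal sums forces equality. Rank thereby detects covers and locates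
the vertices of a chain. -/
theorem PWord.rank_strictMono : StrictMono PWord.rank := by
  intro u v h
  obtain ⟨η, hη, he⟩ := exists_of_le_word (u := u) (ζ := v.toSeq) (by rw [word_toSeq]; exact h.le)
  have hv : v.rank = ∑ i, v.toSeq i := by rw [← rank_word, word_toSeq]
  rw [hv, ← he, rank_word]
  refine lt_of_le_of_ne (Finset.sum_le_sum fun i _ => hη i) fun e => h.ne ?_
  rw [Finset.sum_eq_sum_iff_of_le fun i _ => hη i] at e
  rw [← he, funext fun i => e i (Finset.mem_univ i), word_toSeq]

theorem PWord.covBy_of_rank {u v : PWord} (h : u < v) (hr : v.rank ≤ u.rank + 1) : u ⋖ v :=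
  ⟨h, fun c h₁ h₂ => by
    have := PWord.rank_strictMono h₁
    have := PWord.rank_strictMono h₂
    omega⟩

theorem PWord.eq_of_le_of_rank {u v : PWord} (h : u ≤ v) (hr : v.rank ≤ u.rank) : u = v :=
  h.eq_of_not_lt fun h' => by have := PWord.rank_strictMono h'; omega

/-! ## Letters to the left and to the right of a position -/

/-- The nonzero letters of `ζ` to the left of position `i`. -/
def left (ζ : Fin n → ℕ) (i : ℕ) : List ℕ := nonzero ((List.ofFn ζ).take i)

/-- The nonzero letters of `ζ` to the right of position `i`. -/
def right (ζ : Fin n → ℕ) (i : ℕ) : List ℕ := nonzero ((List.ofFn ζ).drop (i + 1))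

theorem letters_eq (ζ : Fin n → ℕ) (i : Fin n) :
    (word ζ).letters = left ζ i ++ nonzero [ζ i] ++ right ζ i := by
  rw [letters_word, left, right, ← nonzero_append, ← nonzero_append]
  congr 1
  have h : (i : ℕ) < (List.ofFn ζ).length := by simp
  have h' : (List.ofFn ζ)[(i : ℕ)] = ζ i := by simp
  rw [← h', List.append_assoc, List.singleton_append, List.getElem_cons_drop, List.take_append_drop]

theorem left_congr {ζ ξ : Fin n → ℕ} {i : ℕ} (h : ∀ j : Fin n, (j : ℕ) < i → ζ j = ξ j) :
    left ζ i = left ξ i := by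
  rw [left, left]
  congr 1
  refine List.ext_getElem (by simp) fun k h₁ h₂ => ?_
  simp only [List.length_take, List.length_ofFn] at h₁
  simpa using h ⟨k, by omega⟩ (by simp; omega)

theorem right_congr {ζ ξ : Fin n → ℕ} {i : ℕ} (h : ∀ j : Fin n, i < (j : ℕ) → ζ j = ξ j) :
    right ζ i = right ξ i := by
  rw [right, right]
  congr 1
  refine List.ext_getElem (by simp) fun k h₁ h₂ => ?_
  simpa using h _ (by simp; omega)

theorem left_succ (ζ : Fin n → ℕ) (i : Fin n) : left ζ (i + 1) = left ζ i ++ nonzero [ζ i] := by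
  rw [left, left, ← nonzero_append, ← List.take_concat_get (i := (i : ℕ)) (by simp)]
  simp

/-- If `ζ` vanishes strictly between `j` and `i`, then the letter at `j` comes just before `i`. -/
theorem left_eq_concat {ζ : Fin n → ℕ} {j i : Fin n} (hji : j < i) (hj : ζ j ≠ 0)
    (h : ∀ m, j < m → m < i → ζ m = 0) : left ζ i = left ζ j ++ [ζ j] := by
  have key : ∀ k, (j : ℕ) + 1 ≤ k → k ≤ i → left ζ k = left ζ j ++ [ζ j] := by
    intro k hk
    induction k, hk using Nat.le_induction with
    | base => intro; rw [left_succ, nonzero_singleton hj]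
    | succ k hk ih =>
      intro hki
      have hk' : k < n := by omega
      have := left_succ ζ ⟨k, hk'⟩
      simp only at this
      rw [this, ih (by omega), h ⟨k, hk'⟩ (Fin.lt_def.2 (by simp; omega)) (Fin.lt_def.2 (by simp; omega)),
        nonzero_singleton_zero, List.append_nil]
  exact key i (by omega) le_rfl

theorem exists_of_left_eq_concat {ζ : Fin n → ℕ} {i : ℕ} (hi : i ≤ n) {B : List ℕ} {e : ℕ}
    (h : left ζ i = B ++ [e]) :
    ∃ j : Fin n, (j : ℕ) < i ∧ ζ j = e ∧ left ζ j = B ∧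
      ∀ m : Fin n, j < m → (m : ℕ) < i → ζ m = 0 := by
  induction i with
  | zero => simp [left, nonzero] at h
  | succ i ih =>
    have h1 := left_succ ζ ⟨i, hi⟩
    simp only at h1
    rw [h1] at h
    by_cases h0 : ζ ⟨i, hi⟩ = 0
    · rw [h0, nonzero_singleton_zero, List.append_nil] at h
      obtain ⟨j, hj, hje, hB, hz⟩ := ih (by omega) h
      refine ⟨j, by omega, hje, hB, fun m hm hmi => ?_⟩
      rcases Nat.lt_succ_iff_lt_or_eq.1 hmi with h' | h'
      · exact hz m hm h'
      · rw [← h0]; congr 1; exact Fin.ext h'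
    · rw [nonzero_singleton h0] at h
      have h2 := List.append_inj' h rfl
      refine ⟨⟨i, hi⟩, by simp, by simpa using h2.2, h2.1, fun m hm hmi => ?_⟩
      rw [Fin.lt_def] at hm
      simp only at hm
      omega

theorem ne_zero_of_mem_left {ζ : Fin n → ℕ} {i a : ℕ} (h : a ∈ left ζ i) : a ≠ 0 :=
  ne_zero_of_mem_nonzero h

/-- Turns the condition on runs into one about the list `left ζ i`, which can be transported along a
chain. -/
theorem isRunStart_iff {ζ : Fin n → ℕ} {i : Fin n} :
    IsRunStart ζ i ↔ (left ζ i).getLast? ≠ some (ζ i) := by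
  constructor
  · intro h h'
    obtain ⟨B, hB⟩ := List.getLast?_eq_some_iff.1 h'
    obtain ⟨j, hj, hje, -, hz⟩ := exists_of_left_eq_concat i.2.le hB
    have h0 : ζ i ≠ 0 := ne_zero_of_mem_left (i := i) (by rw [hB]; simp)
    exact h j (Fin.lt_def.2 hj) (by rwa [hje]) (fun m hm hmi => hz m hm hmi) hje
  · intro h j hj h0 hz e
    exact h (by rw [left_eq_concat hj h0 hz, List.getLast?_concat, e])

/-! ## Decreasing a letter -/

/-- Decrease the letter at position `i`. -/
def dec (ζ : Fin n → ℕ) (i : Fin n) : Fin n → ℕ := Function.update ζ i (ζ i - 1)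

@[simp] theorem dec_self (ζ : Fin n → ℕ) (i : Fin n) : dec ζ i i = ζ i - 1 :=
  Function.update_self ..

theorem dec_of_ne {ζ : Fin n → ℕ} {i j : Fin n} (h : j ≠ i) : dec ζ i j = ζ j :=
  Function.update_of_ne h ..

theorem dec_le (ζ : Fin n → ℕ) (i j : Fin n) : dec ζ i j ≤ ζ j := by
  rcases eq_or_ne j i with rfl | h
  · simp
  · rw [dec_of_ne h]

/-- A position that can be decreased in passing to the normal embedding of a covered word: the
letter is at least `2`, or it is the first one of a run of ones. -/
def Legal (ζ : Fin n → ℕ) (i : Fin n) : Prop := ζ i ≠ 0 ∧ (ζ i = 1 → IsRunStart ζ i)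

theorem left_dec_of_le {ζ : Fin n → ℕ} {i : Fin n} {k : ℕ} (h : k ≤ i) :
    left (dec ζ i) k = left ζ k :=
  left_congr fun j hj => dec_of_ne (by rintro rfl; omega)

theorem right_dec_of_le {ζ : Fin n → ℕ} {i : Fin n} {k : ℕ} (h : (i : ℕ) ≤ k) :
    right (dec ζ i) k = right ζ k :=
  right_congr fun j hj => dec_of_ne (by rintro rfl; omega)

theorem rank_dec {ζ : Fin n → ℕ} {i : Fin n} (h : ζ i ≠ 0) :
    (word (dec ζ i)).rank + 1 = (word ζ).rank := by
  rw [rank_word, rank_word, dec, Finset.sum_update_of_mem (Finset.mem_univ i),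
    Finset.sum_eq_add_sum_sdiff_singleton_of_mem (Finset.mem_univ i) ζ]
  omega

theorem word_dec_covBy {ζ : Fin n → ℕ} {i : Fin n} (h : ζ i ≠ 0) : word (dec ζ i) ⋖ word ζ := by
  have h₁ := rank_dec h
  refine PWord.covBy_of_rank ((word_mono (dec_le ζ i)).lt_of_ne fun e => ?_) (by omega)
  rw [e] at h₁
  omega

/-- In a run of ones it does not matter which letter is deleted. -/
theorem exists_legal_word_dec_eq {ζ : Fin n → ℕ} {i : Fin n} (h : ζ i ≠ 0) :
    ∃ j, Legal ζ j ∧ word (dec ζ j) = word (dec ζ i) := by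
  induction i using WellFoundedLT.induction with
  | ind i ih =>
    by_cases hl : Legal ζ i
    · exact ⟨i, hl, rfl⟩
    · simp only [Legal, not_and, Classical.not_imp] at hl
      obtain ⟨h1, hr⟩ := hl h
      rw [isRunStart_iff, not_not, List.getLast?_eq_some_iff, h1] at hr
      obtain ⟨B, hB⟩ := hr
      obtain ⟨j, hj, hje, hjB, hz⟩ := exists_of_left_eq_concat i.2.le hB
      obtain ⟨k, hk, hk'⟩ := ih j (Fin.lt_def.2 hj) (by omega)
      refine ⟨k, hk, hk'.trans ?_⟩
      have e₁ : left (dec ζ j) i = B := by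
        have : ∀ k, (j : ℕ) + 1 ≤ k → k ≤ i → left (dec ζ j) k = B := by
          intro k hk
          induction k, hk using Nat.le_induction with
          | base =>
            intro
            rw [left_succ, dec_self, hje, nonzero_singleton_zero, List.append_nil,
              left_dec_of_le le_rfl, hjB]
          | succ k hk ih =>
            intro hki
            have hk' : k < n := by omega
            have h1 := left_succ (dec ζ j) ⟨k, hk'⟩
            simp only at h1
            rw [h1, ih (by omega), dec_of_ne (by rw [Ne, Fin.ext_iff]; simp; omega),
              hz ⟨k, hk'⟩ (Fin.lt_def.2 (by simp; omega)) (by simp; omega),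
              nonzero_singleton_zero, List.append_nil]
        exact this i (by omega) le_rfl
      -- Both words spell `B`, then one `1`, then the letters to the right of `i`: the surviving `1`
      -- sits at `i` in one and at `j` in the other.
      rw [← PWord.letters_injective.eq_iff, letters_eq _ i, letters_eq (dec ζ i) i, e₁,
        right_dec_of_le hj.le, right_dec_of_le le_rfl, left_dec_of_le le_rfl, hB, dec_self, h1,
        dec_of_ne (by rintro rfl; omega), h1, nonzero_singleton_zero, List.append_nil,
        nonzero_singleton one_ne_zero]

theorem exists_legal_of_lt {u : PWord} {ζ : Fin n → ℕ} (h : u < word ζ) :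
    ∃ i, Legal ζ i ∧ u ≤ word (dec ζ i) := by
  obtain ⟨η, hη, rfl⟩ := exists_of_le_word h.le
  obtain ⟨i, hi⟩ : ∃ i, η i < ζ i := by
    by_contra! h'
    exact h.ne (congrArg word (funext fun i => le_antisymm (hη i) (h' i)))
  obtain ⟨j, hj, hj'⟩ := exists_legal_word_dec_eq (ζ := ζ) (i := i) (by omega)
  refine ⟨j, hj, ?_⟩
  rw [hj']
  refine word_mono fun k => ?_
  rcases eq_or_ne k i with rfl | hk
  · rw [dec_self]; omega
  · rw [dec_of_ne hk]; exact hη k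

/-- The same middle part `M` serves every sequence that agrees with `ζ` strictly between `i` and
`j`. -/
theorem left_eq_append_of_lt (ζ : Fin n → ℕ) {i j : Fin n} (h : i < j) :
    ∃ M, left ζ j = left ζ i ++ nonzero [ζ i] ++ M ∧
      ∀ ξ : Fin n → ℕ, (∀ k, i < k → k < j → ξ k = ζ k) →
        left ξ j = left ξ i ++ nonzero [ξ i] ++ M := by
  have key : ∀ ξ : Fin n → ℕ, left ξ j = left ξ i ++ nonzero [ξ i] ++
      nonzero (((List.ofFn ξ).take j).drop (i + 1)) := by
    intro ξ
    rw [← left_succ, left, left, ← nonzero_append]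
    congr 1
    conv_lhs => rw [← List.take_append_drop (i + 1) ((List.ofFn ξ).take j), List.take_take,
      min_eq_left (by omega)]
  refine ⟨_, key ζ, fun ξ hξ => ?_⟩
  rw [key ξ]
  congr 2
  refine List.ext_getElem (by simp) fun k h₁ h₂ => ?_
  simp only [List.length_drop, List.length_take, List.length_ofFn] at h₁
  simpa using hξ ⟨i + 1 + k, by omega⟩ (Fin.lt_def.2 (by simp; omega)) (Fin.lt_def.2 (by simp; omega))

/-- After cancelling the common ends, compare the letters from `i` to `j`. If `ζ i ≥ 2` the first
letters differ; if `ζ i = 1 < ζ j` the lengths differ; if both are `1`, then `M ++ [1] = [1] ++ M`,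
so `j` comes just after a `1` and is not a run start. -/
theorem not_word_dec_eq_of_lt {ζ : Fin n → ℕ} {i j : Fin n} (hi : Legal ζ i) (hj : Legal ζ j)
    (hij : i < j) : word (dec ζ i) ≠ word (dec ζ j) := by
  intro e
  have e' := congrArg PWord.letters e
  obtain ⟨M, hM, hM'⟩ := left_eq_append_of_lt ζ hij
  have hM₁ := hM' (dec ζ i) fun k hk _ => dec_of_ne hk.ne'
  rw [letters_eq _ j, letters_eq (dec ζ j) j, right_dec_of_le (Fin.lt_def.1 hij).le,
    right_dec_of_le le_rfl, left_dec_of_le (i := j) le_rfl, dec_self, dec_of_ne hij.ne',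
    hM₁, dec_self, left_dec_of_le le_rfl, hM, nonzero_singleton hi.1, nonzero_singleton hj.1] at e'
  have e₂ := List.append_cancel_right e'
  simp only [List.append_assoc] at e₂
  have e₃ := List.append_cancel_left e₂
  have hi0 := hi.1
  have hj0 := hj.1
  by_cases hi1 : ζ i = 1
  · by_cases hj1 : ζ j = 1
    · have := isRunStart_iff.1 (hj.2 hj1)
      rw [hM, nonzero_singleton hi0] at this
      simp only [hi1, hj1, Nat.sub_self, nonzero_singleton_zero, List.append_nil,
        List.nil_append] at e₃
      rw [hj1, hi1, List.append_assoc, ← e₃, ← List.append_assoc, List.getLast?_concat] at this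
      exact this rfl
    · have := congrArg List.length e₃
      rw [hi1, nonzero_singleton_zero, nonzero_singleton (by omega)] at this
      simp at this
  · rw [nonzero_singleton (by omega)] at e₃
    simp at e₃
    omega

theorem Legal.eq_of_word_dec_eq {ζ : Fin n → ℕ} {i j : Fin n} (hi : Legal ζ i) (hj : Legal ζ j)
    (h : word (dec ζ i) = word (dec ζ j)) : i = j := by
  rcases lt_trichotomy i j with hij | hij | hij
  · exact absurd h (not_word_dec_eq_of_lt hi hj hij)
  · exact hij
  · exact absurd h.symm (not_word_dec_eq_of_lt hj hi hij)

/-- Justifies the choice in `nextEmbedding`. By rank exactly one letter drops, by one; condition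
`run_one` makes its position legal, and legal positions are determined by the resulting word. -/
theorem isNormalEmbedding_dec_iff {ζ η : Fin n → ℕ} {i : Fin n} (hi : Legal ζ i) :
    IsNormalEmbedding (word (dec ζ i)) ζ η ↔ η = dec ζ i := by
  constructor
  · intro h
    have he := isExpansion_iff.1 h.isEmbedding.1
    obtain ⟨j, hj⟩ : ∃ j, η j < ζ j := by
      by_contra! h'
      have : η = ζ := funext fun k => le_antisymm (h.isEmbedding.2 k) (h' k)
      rw [this] at he
      exact (word_dec_covBy hi.1).lt.ne he.symm
    have hle : ∀ k, η k ≤ dec ζ j k := fun k => by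
      rcases eq_or_ne k j with rfl | hk
      · rw [dec_self]; omega
      · rw [dec_of_ne hk]; exact h.isEmbedding.2 k
    have hr := rank_dec hi.1
    have hr' := rank_dec (show ζ j ≠ 0 by omega)
    rw [← he, rank_word] at hr
    rw [rank_word] at hr'
    have heq : η = dec ζ j := by
      have : ∑ k, η k = ∑ k, dec ζ j k := by omega
      rw [Finset.sum_eq_sum_iff_of_le fun k _ => hle k] at this
      exact funext fun k => this k (Finset.mem_univ k)
    have hjl : Legal ζ j := ⟨by omega, fun h1 => by
      by_contra hr
      exact h.run_one j h1 hr (by omega)⟩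
    rw [heq] at he
    rw [heq, hjl.eq_of_word_dec_eq hi he]
  · rintro rfl
    refine ⟨⟨isExpansion_iff.2 rfl, dec_le ζ i⟩, fun j => ?_, fun j h1 hr => ?_, fun j h2 _ => ?_⟩
    · rcases eq_or_ne j i with rfl | hj
      · rw [dec_self]; omega
      · rw [dec_of_ne hj]; exact .inl rfl
    · rcases eq_or_ne j i with rfl | hj
      · exact absurd (hi.2 h1) hr
      · rw [dec_of_ne hj]; omega
    · rcases eq_or_ne j i with rfl | hj
      · rw [dec_self]; omega
      · rw [dec_of_ne hj]; omega

theorem nextEmbedding_word_dec {ζ : Fin n → ℕ} {i : Fin n} (hi : Legal ζ i) :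
    nextEmbedding ζ (word (dec ζ i)) = dec ζ i := by
  have := Classical.epsilon_spec (p := fun η => IsNormalEmbedding (word (dec ζ i)) ζ η)
    ⟨dec ζ i, (isNormalEmbedding_dec_iff hi).2 rfl⟩
  exact (isNormalEmbedding_dec_iff hi).1 this

theorem decreasedPosition_dec {ζ : Fin n → ℕ} {i : Fin n} (hi : ζ i ≠ 0) :
    decreasedPosition ζ (dec ζ i) = i := by
  have : {k : ℕ | ∃ h : k < n, dec ζ i ⟨k, h⟩ < ζ ⟨k, h⟩} = {(i : ℕ)} := by
    ext k
    simp only [Set.mem_ofPred_eq, Set.mem_singleton_iff]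
    constructor
    · rintro ⟨h, h'⟩
      by_contra hk
      rw [dec_of_ne (by rw [Ne, Fin.ext_iff]; exact hk)] at h'
      exact lt_irrefl _ h'
    · rintro rfl
      exact ⟨i.2, by simp; omega⟩
  rw [decreasedPosition, this, csInf_singleton]

theorem exists_legal_of_covBy {v : PWord} {ζ : Fin n → ℕ} (h : v ⋖ word ζ) :
    ∃ i, Legal ζ i ∧ v = word (dec ζ i) := by
  obtain ⟨i, hi, hle⟩ := exists_legal_of_lt h.lt
  refine ⟨i, hi, ?_⟩
  by_contra hne
  exact h.2 (lt_of_le_of_ne hle hne) (word_dec_covBy hi.1).lt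

end CompositionPoset

namespace CompositionPoset

open BabsonHersh

/-! ## Vertices, embeddings and labels of a maximal chain, by index -/

variable {u w : PWord}

/-- The number of edges of a maximal chain. -/
def depth (C : MaxChain u w) : ℕ := C.verts.length - 1

/-- The `j`-th vertex of a maximal chain, counted from the top. -/
def vtx (C : MaxChain u w) (j : ℕ) : PWord := C.verts.getD j w

/-- The embedding `η_{v_j}` of the `j`-th vertex into `w`. -/
noncomputable def emb (C : MaxChain u w) (j : ℕ) : Fin w.parts.length → ℕ :=
  (C.verts.tail.take j).foldl nextEmbedding w.toSeq

/-- The label of the edge from the `j`-th vertex to the next one. -/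
noncomputable def lab (C : MaxChain u w) (j : ℕ) : ℕ :=
  decreasedPosition (emb C j) (emb C (j + 1))

theorem verts_ne_nil (C : MaxChain u w) : C.verts ≠ [] := by
  intro h
  have := C.head_eq
  simp [h] at this

theorem length_verts (C : MaxChain u w) : C.verts.length = depth C + 1 := by
  have := List.length_pos_iff.2 (verts_ne_nil C)
  rw [depth]; omega

theorem vtx_eq (C : MaxChain u w) {j : ℕ} (h : j ≤ depth C) :
    vtx C j = C.verts[j]'(by rw [length_verts]; omega) :=
  List.getD_eq_getElem ..

theorem vtx_zero (C : MaxChain u w) : vtx C 0 = w := by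
  have := C.head_eq
  rw [List.head?_eq_getElem?] at this
  rw [vtx, List.getD_eq_getElem?_getD, this]
  rfl

theorem vtx_depth (C : MaxChain u w) : vtx C (depth C) = u := by
  have := C.last_eq
  rw [List.getLast?_eq_getElem?] at this
  rw [vtx, List.getD_eq_getElem?_getD, depth, this]
  rfl

theorem vtx_covBy (C : MaxChain u w) {j : ℕ} (h : j < depth C) : vtx C (j + 1) ⋖ vtx C j := by
  have := List.isChain_iff_getElem.1 C.covers j (by rw [length_verts]; omega)
  rwa [vtx_eq C h, vtx_eq C h.le]

theorem mem_verts_iff {C : MaxChain u w} {v : PWord} :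
    v ∈ C.verts ↔ ∃ j ≤ depth C, vtx C j = v := by
  rw [List.mem_iff_getElem]
  constructor
  · rintro ⟨j, hj, rfl⟩
    rw [length_verts] at hj
    exact ⟨j, by omega, vtx_eq C (by omega)⟩
  · rintro ⟨j, hj, rfl⟩
    exact ⟨j, by rw [length_verts]; omega, (vtx_eq C hj).symm⟩

theorem ext_vtx {C C' : MaxChain u w} (hd : depth C = depth C')
    (h : ∀ j ≤ depth C, vtx C j = vtx C' j) : C = C' := by
  refine MaxChain.ext (List.ext_getElem (by rw [length_verts, length_verts, hd]) fun j h₁ h₂ => ?_)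
  rw [length_verts] at h₁ h₂
  rw [← vtx_eq C (by omega), ← vtx_eq C' (by omega), h j (by omega)]

theorem emb_zero (C : MaxChain u w) : emb C 0 = w.toSeq := rfl

theorem emb_succ (C : MaxChain u w) {j : ℕ} (h : j < depth C) :
    emb C (j + 1) = nextEmbedding (emb C j) (vtx C (j + 1)) := by
  have hl : j < C.verts.tail.length := by rw [List.length_tail, length_verts]; omega
  rw [emb, ← List.take_concat_get hl, List.concat_eq_append, List.foldl_concat, vtx_eq C h]
  simp [emb]

theorem endEmbedding_eq (C : MaxChain u w) : endEmbedding C = emb C (depth C) := by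
  rw [endEmbedding, emb, List.take_of_length_le]
  rw [List.length_tail, depth]

/-- Every edge of a maximal chain decreases the letter at a legal position, which is its label. -/
theorem exists_step_of_word_emb {C : MaxChain u w} {j : ℕ} (h : j < depth C)
    (hw : word (emb C j) = vtx C j) :
    ∃ p : Fin w.parts.length, Legal (emb C j) p ∧ emb C (j + 1) = dec (emb C j) p ∧
      lab C j = p ∧ word (emb C (j + 1)) = vtx C (j + 1) := by
  have hc := vtx_covBy C h
  rw [← hw] at hc
  obtain ⟨p, hp, hv⟩ := exists_legal_of_covBy hc
  have he : emb C (j + 1) = dec (emb C j) p := by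
    rw [emb_succ C h, hv, nextEmbedding_word_dec hp]
  exact ⟨p, hp, he, by rw [lab, he, decreasedPosition_dec hp.1], by rw [he, hv]⟩

theorem word_emb (C : MaxChain u w) {j : ℕ} (h : j ≤ depth C) : word (emb C j) = vtx C j := by
  induction j with
  | zero => rw [emb_zero, vtx_zero, word_toSeq]
  | succ j ih =>
    obtain ⟨_, -, -, -, h'⟩ := exists_step_of_word_emb h (ih (by omega))
    exact h'

theorem exists_step (C : MaxChain u w) {j : ℕ} (h : j < depth C) :
    ∃ p : Fin w.parts.length, Legal (emb C j) p ∧ emb C (j + 1) = dec (emb C j) p ∧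
      lab C j = p := by
  obtain ⟨p, h₁, h₂, h₃, -⟩ := exists_step_of_word_emb h (word_emb C h.le)
  exact ⟨p, h₁, h₂, h₃⟩

theorem rank_vtx (C : MaxChain u w) {j : ℕ} (h : j ≤ depth C) :
    (vtx C j).rank + j = w.rank := by
  induction j with
  | zero => rw [vtx_zero, add_zero]
  | succ j ih =>
    obtain ⟨p, hp, he, -⟩ := exists_step C h
    have := rank_dec hp.1
    rw [← he, word_emb C h, word_emb C (by omega)] at this
    have := ih (by omega)
    omega

theorem depth_eq (C : MaxChain u w) : depth C + u.rank = w.rank := by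
  have := rank_vtx C le_rfl
  rw [vtx_depth] at this
  omega

theorem depth_eq_depth (C C' : MaxChain u w) : depth C = depth C' := by
  have := depth_eq C
  have := depth_eq C'
  omega

theorem vtx_le_vtx (C : MaxChain u w) {i j : ℕ} (hij : i ≤ j) (hj : j ≤ depth C) :
    vtx C j ≤ vtx C i := by
  induction j, hij using Nat.le_induction with
  | base => exact le_rfl
  | succ j hij ih => exact (vtx_covBy C hj).le.trans (ih (by omega))

theorem vtx_lt_vtx_iff (C : MaxChain u w) {i j : ℕ} (hi : i ≤ depth C) (hj : j ≤ depth C) :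
    vtx C j < vtx C i ↔ i < j := by
  have h₁ := rank_vtx C hi
  have h₂ := rank_vtx C hj
  constructor
  · intro h
    have := PWord.rank_strictMono h
    omega
  · intro h
    refine (vtx_le_vtx C h.le hj).lt_of_ne fun e => ?_
    rw [e] at h₂
    omega

/-- The index is read off from the rank, so a word shared by two chains has the same index in both.
-/
theorem eq_of_vtx_eq {C C' : MaxChain u w} {i j : ℕ} (hi : i ≤ depth C) (hj : j ≤ depth C)
    (h : vtx C i = vtx C' j) : i = j := by
  have h₁ := rank_vtx C hi
  have h₂ := rank_vtx C' (depth_eq_depth C C' ▸ hj)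
  rw [h] at h₁
  omega

theorem labelsFrom_eq {n : ℕ} (ζ : Fin n → ℕ) (l : List PWord) :
    labelsFrom ζ l = (List.range l.length).map fun j =>
      decreasedPosition ((l.take j).foldl nextEmbedding ζ)
        ((l.take (j + 1)).foldl nextEmbedding ζ) := by
  induction l generalizing ζ with
  | nil => rfl
  | cons v l ih =>
    rw [labelsFrom, ih, List.length_cons, List.range_succ_eq_map]
    simp

theorem labels_eq (C : MaxChain u w) : labels C = (List.range (depth C)).map (lab C) := by
  rw [labels, labelsFrom_eq, List.length_tail]
  rfl

theorem precedes_iff {C' C : MaxChain u w} :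
    Precedes C' C ↔ ∃ i < depth C, (∀ k < i, lab C' k = lab C k) ∧ lab C' i < lab C i := by
  have hl : ∀ D : MaxChain u w, (labels D).length = depth D := fun D => by simp [labels_eq]
  have hg : ∀ (D : MaxChain u w) (i : ℕ) (h : i < (labels D).length), (labels D)[i] = lab D i := by
    intro D i h
    simp [labels_eq]
  have hd := depth_eq_depth C' C
  change labels C' < labels C ↔ _
  rw [List.lt_iff_exists]
  constructor
  · rintro (⟨-, h⟩ | ⟨i, h₁, h₂, h₃, h₄⟩)
    · rw [hl, hl] at h; omega
    · refine ⟨i, by rwa [hl] at h₂, fun k hk => ?_, by simpa [hg] using h₄⟩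
      simpa [hg] using h₃ k hk
  · rintro ⟨i, hi, h₁, h₂⟩
    refine .inr ⟨i, by rw [hl]; omega, by rw [hl]; omega, fun k hk => ?_, by simpa [hg] using h₂⟩
    simpa [hg] using h₁ k hk

theorem weaklyDecreasing_iff {C : MaxChain u w} :
    WeaklyDecreasing C ↔ ∀ i j, i < j → j < depth C → lab C j ≤ lab C i := by
  rw [WeaklyDecreasing, labels_eq, List.pairwise_iff_getElem]
  simp only [List.length_map, List.length_range, List.getElem_map, List.getElem_range]
  exact ⟨fun h i j hij hj => h i j (by omega) hj hij, fun h i j _ hj hij => h i j hij hj⟩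

/-- Labels determine the embeddings. -/
theorem emb_eq_of_lab_eq {C C' : MaxChain u w} {i : ℕ} (hi : i ≤ depth C)
    (h : ∀ k < i, lab C' k = lab C k) : emb C' i = emb C i := by
  induction i with
  | zero => rfl
  | succ i ih =>
    obtain ⟨p, -, he, hl⟩ := exists_step C hi
    obtain ⟨q, -, he', hl'⟩ := exists_step C' (depth_eq_depth C C' ▸ hi)
    have hpq : q = p := Fin.ext (by rw [← hl, ← hl', h i (by omega)])
    rw [he, he', ih (by omega) (fun k hk => h k (by omega)), hpq]

theorem vtx_eq_of_lab_eq {C C' : MaxChain u w} {i : ℕ} (hi : i ≤ depth C)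
    (h : ∀ k < i, lab C' k = lab C k) : vtx C' i = vtx C i := by
  rw [← word_emb C hi, ← word_emb C' (depth_eq_depth C C' ▸ hi), emb_eq_of_lab_eq hi h]

theorem eq_of_labels_eq {C C' : MaxChain u w} (h : labels C' = labels C) : C' = C := by
  have hd := depth_eq_depth C' C
  rw [labels_eq, labels_eq, hd, List.map_inj_left] at h
  exact ext_vtx hd fun j hj => vtx_eq_of_lab_eq (by omega) fun k hk =>
    h k (List.mem_range.2 (by omega))

/-- The bottoms `u` and `u'` may differ, because `exists_weaklyDecreasing` prolongs a chain by one
edge. -/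
theorem emb_eq_of_vtx_eq {u' : PWord} {C : MaxChain u w} {C' : MaxChain u' w} {i : ℕ}
    (hi : i ≤ depth C) (hi' : i ≤ depth C') (h : ∀ k ≤ i, vtx C' k = vtx C k) :
    emb C' i = emb C i := by
  induction i with
  | zero => rfl
  | succ i ih =>
    rw [emb_succ C hi, emb_succ C' hi', ih (by omega) (by omega) (fun k hk => h k (by omega)),
      h _ le_rfl]

/-- A maximal chain from a sequence of vertices. -/
def mkChain (f : ℕ → PWord) (d : ℕ) (h₀ : f 0 = w) (hd : f d = u)
    (hf : ∀ j < d, f (j + 1) ⋖ f j) : MaxChain u w where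
  verts := (List.range (d + 1)).map f
  head_eq := by simp [List.head?_range, h₀]
  last_eq := by simp [List.getLast?_range, hd]
  covers := by
    rw [List.isChain_iff_getElem]
    intro j hj
    simp only [List.length_map, List.length_range] at hj
    simpa using hf j (by omega)

theorem depth_mkChain {f : ℕ → PWord} {d : ℕ} {h₀ : f 0 = w} {hd : f d = u}
    {hf : ∀ j < d, f (j + 1) ⋖ f j} : depth (mkChain f d h₀ hd hf) = d := by
  simp [depth, mkChain]

theorem vtx_mkChain {f : ℕ → PWord} {d : ℕ} {h₀ : f 0 = w} {hd : f d = u}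
    {hf : ∀ j < d, f (j + 1) ⋖ f j} {j : ℕ} (h : j ≤ d) : vtx (mkChain f d h₀ hd hf) j = f j := by
  rw [vtx_eq _ (by rwa [depth_mkChain])]
  simp [mkChain]

/-- Intervals of the composition poset have maximal chains. -/
theorem exists_saturated {x y : PWord} (h : x ≤ y) :
    ∃ (m : ℕ) (g : ℕ → PWord), g 0 = y ∧ g m = x ∧ (∀ k < m, g (k + 1) ⋖ g k) ∧
      x.rank + m = y.rank := by
  induction hr : y.rank using Nat.strong_induction_on generalizing y with
  | _ r ih =>
    rcases h.eq_or_lt with rfl | hlt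
    · exact ⟨0, fun _ => x, rfl, rfl, by simp, by simpa using hr⟩
    · obtain ⟨i, hi, hle⟩ := exists_legal_of_lt (ζ := y.toSeq) (by rwa [word_toSeq])
      have hc := word_dec_covBy hi.1
      have hk := rank_dec hi.1
      rw [word_toSeq] at hc hk
      obtain ⟨m, g, h₀, hm, hg, hgr⟩ := ih _ (by omega) hle rfl
      refine ⟨m + 1, fun k => if k = 0 then y else g (k - 1), by simp, by simpa using hm, ?_, by omega⟩
      intro k hkm
      rcases Nat.eq_zero_or_pos k with rfl | hk0
      · simpa [h₀] using hc
      · have := hg (k - 1) (by omega)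
        rw [Nat.sub_add_cancel hk0] at this
        simpa [hk0.ne'] using this

/-- Replace the part of `C` between its vertices `i` and `j` by a detour through `v`. -/
theorem exists_detour (C : MaxChain u w) {i j : ℕ} (hij : i < j) (hj : j ≤ depth C) {v : PWord}
    (hv : v ⋖ vtx C i) (hjv : vtx C j ≤ v) :
    ∃ C' : MaxChain u w, (∀ k, k ≤ depth C → k ≤ i ∨ j ≤ k → vtx C' k = vtx C k) ∧
      vtx C' (i + 1) = v := by
  have hvr : v.rank + (i + 1) = w.rank := by
    have h1 := rank_vtx C (show i ≤ depth C by omega)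
    obtain ⟨p, hp, rfl⟩ := exists_legal_of_covBy (by rwa [word_emb C (by omega)] : v ⋖ word (emb C i))
    have := rank_dec hp.1
    rw [word_emb C (by omega)] at this
    omega
  obtain ⟨m, g, h₀, hm, hg, hr⟩ := exists_saturated hjv
  have hjr := rank_vtx C hj
  have hmj : m = j - i - 1 := by omega
  subst hmj
  let f : ℕ → PWord := fun k => if k ≤ i then vtx C k else if k ≤ j then g (k - i - 1) else vtx C k
  have hf1 : ∀ k, k ≤ i → f k = vtx C k := fun k hk => by simp [f, hk]
  have hf2 : ∀ k, i < k → k ≤ j → f k = g (k - i - 1) := fun k hk hk' => by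
    simp [f, hk', not_le.2 hk]
  have hf3 : ∀ k, j ≤ k → f k = vtx C k := fun k hk => by
    rcases hk.eq_or_lt with rfl | hk
    · rw [hf2 j hij le_rfl, hm]
    · simp [f, not_le.2 hk, not_le.2 (hij.trans hk)]
  refine ⟨mkChain f (depth C) (by rw [hf1 0 (by omega), vtx_zero]) (by rw [hf3 _ hj, vtx_depth]) ?_,
    ?_, ?_⟩
  · intro k hk
    rcases lt_trichotomy k i with h | rfl | h
    · rw [hf1 _ h, hf1 _ h.le]; exact vtx_covBy C hk
    · rw [hf1 _ le_rfl, hf2 _ (by omega) (by omega)]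
      simpa [h₀] using hv
    · by_cases hkj : k < j
      · rw [hf2 _ h hkj.le, hf2 _ (by omega) hkj]
        have := hg (k - i - 1) (by omega)
        rwa [show k - i - 1 + 1 = k + 1 - i - 1 by omega] at this
      · rw [hf3 _ (by omega), hf3 _ (by omega)]; exact vtx_covBy C hk
  · intro k hk h
    rw [vtx_mkChain hk]
    rcases h with h | h
    · exact hf1 k h
    · exact hf3 k h
  · rw [vtx_mkChain (by omega), hf2 _ (by omega) (by omega)]
    simpa using h₀

end CompositionPoset

namespace CompositionPoset

open BabsonHersh

variable {u w : PWord}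

/-! ## How the embeddings change along a chain -/

theorem emb_succ_of_lab_eq {C : MaxChain u w} {j : ℕ} (h : j < depth C) {p : Fin w.parts.length}
    (hp : lab C j = p) : emb C (j + 1) p + 1 = emb C j p := by
  obtain ⟨q, hq, he, hl⟩ := exists_step C h
  have : q = p := Fin.ext (by omega)
  subst this
  have := hq.1
  rw [he, dec_self]
  omega

theorem emb_succ_of_lab_ne {C : MaxChain u w} {j : ℕ} (h : j < depth C) {p : Fin w.parts.length}
    (hp : lab C j ≠ p) : emb C (j + 1) p = emb C j p := by
  obtain ⟨q, hq, he, hl⟩ := exists_step C h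
  rw [he, dec_of_ne]
  rintro rfl
  exact hp hl

theorem emb_le_emb (C : MaxChain u w) {i j : ℕ} (hij : i ≤ j) (hj : j ≤ depth C)
    (p : Fin w.parts.length) : emb C j p ≤ emb C i p := by
  induction j, hij using Nat.le_induction with
  | base => exact le_rfl
  | succ j hij ih =>
    refine le_trans ?_ (ih (by omega))
    by_cases h : lab C j = p
    · have := emb_succ_of_lab_eq hj h
      omega
    · exact (emb_succ_of_lab_ne hj h).le

theorem emb_eq_of_lab_ne {C : MaxChain u w} {i j : ℕ} (hij : i ≤ j) (hj : j ≤ depth C)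
    {p : Fin w.parts.length} (h : ∀ k, i ≤ k → k < j → lab C k ≠ p) : emb C j p = emb C i p := by
  induction j, hij using Nat.le_induction with
  | base => rfl
  | succ j hij ih =>
    rw [emb_succ_of_lab_ne hj (h j hij (by omega)), ih (by omega) fun k hk hk' => h k hk (by omega)]

theorem exists_lab_eq {C : MaxChain u w} {i j : ℕ} (hij : i ≤ j) (hj : j ≤ depth C)
    {p : Fin w.parts.length} (h : emb C j p ≠ emb C i p) : ∃ k, i ≤ k ∧ k < j ∧ lab C k = p := by
  by_contra! h'
  exact h (emb_eq_of_lab_ne hij hj h')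

theorem emb_of_lab_const {C : MaxChain u w} {i j : ℕ} (hij : i ≤ j) (hj : j ≤ depth C)
    {p : Fin w.parts.length} (h : ∀ k, i ≤ k → k < j → lab C k = p) :
    emb C j p + (j - i) = emb C i p := by
  induction j, hij using Nat.le_induction with
  | base => simp
  | succ j hij ih =>
    have := emb_succ_of_lab_eq hj (h j hij (by omega))
    have := ih (by omega) fun k hk hk' => h k hk (by omega)
    omega

theorem left_emb_eq {C : MaxChain u w} {i j m : ℕ} (hij : i ≤ j) (hj : j ≤ depth C)
    (h : ∀ k, i ≤ k → k < j → m ≤ lab C k) : left (emb C j) m = left (emb C i) m :=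
  left_congr fun p hp => emb_eq_of_lab_ne hij hj fun k hk hk' e => by
    have := h k hk hk'
    omega

theorem right_emb_eq {C : MaxChain u w} {i j m : ℕ} (hij : i ≤ j) (hj : j ≤ depth C)
    (h : ∀ k, i ≤ k → k < j → lab C k ≤ m) : right (emb C j) m = right (emb C i) m :=
  right_congr fun p hp => emb_eq_of_lab_ne hij hj fun k hk hk' e => by
    have := h k hk hk'
    omega

/-! ## Open intervals of a chain -/

/-- The open interval of `C` between its vertices `i` and `j`. -/
noncomputable def seg (C : MaxChain u w) (i j : ℕ) : Finset PWord :=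
  C.openInterval (vtx C i) (vtx C j)

theorem mem_seg {C : MaxChain u w} {i j : ℕ} (hi : i ≤ depth C) (hj : j ≤ depth C) {v : PWord} :
    v ∈ seg C i j ↔ ∃ k, i < k ∧ k < j ∧ vtx C k = v := by
  simp only [seg, MaxChain.openInterval, Finset.mem_filter, List.mem_toFinset, mem_verts_iff]
  constructor
  · rintro ⟨⟨k, hk, rfl⟩, h₁, h₂⟩
    rw [vtx_lt_vtx_iff C hk hj] at h₁
    rw [vtx_lt_vtx_iff C hi hk] at h₂
    exact ⟨k, h₂, h₁, rfl⟩
  · rintro ⟨k, h₁, h₂, rfl⟩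
    exact ⟨⟨k, by omega, rfl⟩, (vtx_lt_vtx_iff C (by omega) hj).2 h₂,
      (vtx_lt_vtx_iff C hi (by omega)).2 h₁⟩

theorem vtx_mem_seg {C : MaxChain u w} {i j k : ℕ} (hi : i ≤ depth C) (hj : j ≤ depth C)
    (hk : k ≤ depth C) : vtx C k ∈ seg C i j ↔ i < k ∧ k < j := by
  rw [mem_seg hi hj]
  constructor
  · rintro ⟨l, h₁, h₂, h⟩
    have := eq_of_vtx_eq (show l ≤ depth C by omega) hk h
    omega
  · rintro ⟨h₁, h₂⟩
    exact ⟨k, h₁, h₂, rfl⟩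

theorem interior_eq_seg (C : MaxChain u w) : C.interior = seg C 0 (depth C) := by
  rw [MaxChain.interior, seg, vtx_zero, vtx_depth]

theorem mem_interior {C : MaxChain u w} {v : PWord} :
    v ∈ C.interior ↔ ∃ k, 0 < k ∧ k < depth C ∧ vtx C k = v := by
  rw [interior_eq_seg, mem_seg (Nat.zero_le _) le_rfl]

theorem seg_subset_interior (C : MaxChain u w) {i j : ℕ} (hi : i ≤ depth C) (hj : j ≤ depth C) :
    seg C i j ⊆ C.interior := fun v hv => by
  obtain ⟨k, h₁, h₂, rfl⟩ := (mem_seg hi hj).1 hv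
  exact mem_interior.2 ⟨k, by omega, by omega, rfl⟩

theorem seg_subset_seg_iff {C : MaxChain u w} {i j i' j' : ℕ} (hij : i + 1 < j) (hj : j ≤ depth C)
    (hi' : i' ≤ depth C) (hj' : j' ≤ depth C) : seg C i j ⊆ seg C i' j' ↔ i' ≤ i ∧ j ≤ j' := by
  constructor
  · intro h
    have h₁ := h ((vtx_mem_seg (by omega) hj (by omega)).2 ⟨Nat.lt_succ_self i, hij⟩)
    have h₂ := h ((vtx_mem_seg (by omega) hj (k := j - 1) (by omega)).2 ⟨by omega, by omega⟩)
    rw [vtx_mem_seg hi' hj' (by omega)] at h₁ h₂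
    omega
  · rintro ⟨h₁, h₂⟩ v hv
    obtain ⟨k, hk, hk', rfl⟩ := (mem_seg (by omega) hj).1 hv
    exact (mem_seg hi' hj').2 ⟨k, by omega, by omega, rfl⟩

/-! ## Skipped intervals -/

/-- At its `i`-th vertex the chain could take an edge with a smaller label and still reach its `j`-th
vertex. -/
def Alt (C : MaxChain u w) (i j : ℕ) : Prop :=
  ∃ b : Fin w.parts.length, Legal (emb C i) b ∧ (b : ℕ) < lab C i ∧
    vtx C j ≤ word (dec (emb C i) b)

/-- For `j = i + 1` equal ranks would make the detour end at the vertex `j` itself, and then its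
label would be that of `C`. -/
theorem Alt.lt {C : MaxChain u w} {i j : ℕ} (h : Alt C i j) (hi : i < depth C) (hj : j ≤ depth C) :
    i + 1 < j := by
  obtain ⟨b, hb, hlt, hle⟩ := h
  obtain ⟨p, hp, he, hl⟩ := exists_step C hi
  have hr := rank_dec hb.1
  rw [word_emb C hi.le] at hr
  have h₁ := rank_vtx C hi.le
  have h₂ := rank_vtx C hj
  have h₃ := PWord.rank_strictMono.monotone hle
  refine lt_of_le_of_ne (by omega) fun hij => ?_
  have heq := PWord.eq_of_le_of_rank hle (by omega)
  rw [← hij, ← word_emb C hi, he] at heq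
  have := hp.eq_of_word_dec_eq hb heq
  rw [this] at hl
  omega

theorem Alt.exists_precedes {C : MaxChain u w} {i j : ℕ} (h : Alt C i j) (hi : i < depth C)
    (hj : j ≤ depth C) :
    ∃ C', Precedes C' C ∧ ∀ k ≤ depth C, k ≤ i ∨ j ≤ k → vtx C' k = vtx C k := by
  have hij := h.lt hi hj
  obtain ⟨b, hb, hlt, hle⟩ := h
  have hc := word_dec_covBy hb.1
  rw [word_emb C hi.le] at hc
  obtain ⟨C', hC, hv⟩ := exists_detour C (by omega) hj hc hle
  refine ⟨C', precedes_iff.2 ?_, hC⟩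
  have he : ∀ k ≤ i, emb C' k = emb C k := fun k hk =>
    emb_eq_of_vtx_eq (by omega) (by rw [depth_eq_depth C' C]; omega) fun l hl => hC l (by omega) (.inl (by omega))
  refine ⟨i, hi, fun k hk => ?_, ?_⟩
  · rw [lab, lab, he k hk.le, he (k + 1) hk]
  · have hi' : i < depth C' := by rwa [depth_eq_depth C' C]
    have : lab C' i = b := by
      rw [lab, emb_succ C' hi', he i le_rfl, hv, nextEmbedding_word_dec hb,
        decreasedPosition_dec hb.1]
    omega

/-- Where an earlier chain diverges from `C`, it takes an edge with a smaller label. -/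
theorem exists_alt_of_precedes {C' C : MaxChain u w} (h : Precedes C' C) :
    ∃ i < depth C, (∀ k ≤ i, vtx C' k = vtx C k) ∧
      ∀ j, i < j → j ≤ depth C → vtx C' j = vtx C j → Alt C i j := by
  obtain ⟨i, hi, h₁, h₂⟩ := precedes_iff.1 h
  refine ⟨i, hi, fun k hk => vtx_eq_of_lab_eq (by omega) fun l hl => h₁ l (by omega), ?_⟩
  intro j hij hj hv
  have hd := depth_eq_depth C' C
  obtain ⟨b, hb, he, hl⟩ := exists_step C' (hd ▸ hi)
  rw [emb_eq_of_lab_eq hi.le h₁] at hb he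
  refine ⟨b, hb, by omega, ?_⟩
  rw [← he, word_emb C' (hd ▸ hi), ← hv]
  exact vtx_le_vtx C' hij (hd ▸ hj)

theorem isSkipped_iff {C : MaxChain u w} {I : Finset PWord} :
    C.IsSkipped Precedes I ↔ ∃ i i' j, i ≤ i' ∧ i' < depth C ∧ j ≤ depth C ∧ I = seg C i j ∧
      Alt C i' j := by
  constructor
  · rintro ⟨hne, ⟨x, hx, y, hy, rfl⟩, C', hp, hC⟩
    obtain ⟨i, hi, rfl⟩ := mem_verts_iff.1 hx
    obtain ⟨j, hj, rfl⟩ := mem_verts_iff.1 hy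
    change (seg C i j).Nonempty at hne
    have hv : ∀ k ≤ depth C, k ≤ i ∨ j ≤ k → vtx C' k = vtx C k := by
      intro k hk hk'
      have := hC (vtx C k) (mem_verts_iff.2 ⟨k, hk, rfl⟩) (fun h => by
        have := (vtx_mem_seg hi hj hk).1 h
        omega)
      obtain ⟨l, hl, hl'⟩ := mem_verts_iff.1 this
      have := eq_of_vtx_eq hl (depth_eq_depth C' C ▸ hk) hl'
      rw [← hl', this]
    obtain ⟨i', hi', h₁, h₂⟩ := exists_alt_of_precedes hp
    obtain ⟨v, hv'⟩ := hne
    obtain ⟨k, hk, hkj, -⟩ := (mem_seg hi hj).1 hv'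
    -- Outside the interval the chains agree at both `i'` and `i' + 1`, which `Alt.lt` forbids; so
    -- the divergence happens inside.
    have hii : i ≤ i' := by
      by_contra! h
      have := (h₂ (i' + 1) (by omega) (by omega) (hv _ (by omega) (.inl h))).lt hi' (by omega)
      omega
    have hij' : i' < j := by
      by_contra! h
      have := (h₂ (i' + 1) (by omega) (by omega) (hv _ (by omega) (.inr (by omega)))).lt hi' (by omega)
      omega
    exact ⟨i, i', j, hii, hi', hj, rfl, h₂ j hij' hj (hv j hj (.inr le_rfl))⟩
  · rintro ⟨i, i', j, hii, hi', hj, rfl, ha⟩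
    have hlt := ha.lt hi' hj
    obtain ⟨C', hp, hC⟩ := ha.exists_precedes hi' hj
    refine ⟨⟨vtx C (i + 1), (vtx_mem_seg (by omega) hj (by omega)).2 ⟨by omega, by omega⟩⟩,
      ⟨vtx C i, mem_verts_iff.2 ⟨i, by omega, rfl⟩, vtx C j, mem_verts_iff.2 ⟨j, hj, rfl⟩, rfl⟩,
      C', hp, ?_⟩
    intro v hv hvn
    obtain ⟨k, hk, rfl⟩ := mem_verts_iff.1 hv
    rw [vtx_mem_seg (by omega) hj hk] at hvn
    rw [mem_verts_iff]
    exact ⟨k, by rwa [depth_eq_depth C' C], hC k hk (by omega)⟩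

theorem Alt.isSkipped {C : MaxChain u w} {i j : ℕ} (h : Alt C i j) (hi : i < depth C)
    (hj : j ≤ depth C) : C.IsSkipped Precedes (seg C i j) :=
  isSkipped_iff.2 ⟨i, i, j, le_rfl, hi, hj, rfl, h⟩

theorem IsSkipped.subset_interior {C : MaxChain u w} {I : Finset PWord}
    (h : C.IsSkipped Precedes I) : I ⊆ C.interior := by
  obtain ⟨i, i', j, _, _, _, rfl, -⟩ := isSkipped_iff.1 h
  exact seg_subset_interior C (by omega) (by omega)

theorem mem_msi {C : MaxChain u w} {I : Finset PWord} :
    I ∈ C.msi Precedes ↔ Minimal (C.IsSkipped Precedes) I := by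
  simp only [MaxChain.msi, Finset.mem_filter, Finset.mem_powerset, and_iff_right_iff_imp]
  exact fun h => IsSkipped.subset_interior h.1

theorem exists_msi_subset {C : MaxChain u w} {I : Finset PWord} (h : C.IsSkipped Precedes I) :
    ∃ K ∈ C.msi Precedes, K ⊆ I := by
  obtain ⟨K, hK, hm⟩ := exists_minimal_le_of_wellFoundedLT (C.IsSkipped Precedes) I h
  exact ⟨K, mem_msi.2 hm, hK⟩

/-- A face is new if and only if it meets every minimal skipped interval. -/
theorem isNewFace_iff {C : MaxChain u w} {σ : Finset PWord} :
    C.IsNewFace Precedes σ ↔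
      σ ⊆ C.interior ∧ ∀ I ∈ C.msi Precedes, ∃ v ∈ σ, v ∈ I := by
  refine and_congr_right fun hσ => ⟨fun h I hI => ?_, fun h C' hp hσ' => ?_⟩
  · by_contra! hd
    obtain ⟨-, -, C', hp, hC⟩ := (mem_msi.1 hI).1
    refine h C' hp fun v hv => ?_
    obtain ⟨k, hk, hk', rfl⟩ := mem_interior.1 (hσ hv)
    obtain ⟨l, hl, hl'⟩ := mem_verts_iff.1 (hC _ (mem_verts_iff.2 ⟨k, hk'.le, rfl⟩) (hd _ hv))
    have := eq_of_vtx_eq hl (by rw [depth_eq_depth C' C]; omega) hl'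
    subst this
    exact mem_interior.2 ⟨l, hk, by rwa [depth_eq_depth C' C], hl'⟩
  · obtain ⟨i, hi, h₁, h₂⟩ := exists_alt_of_precedes hp
    -- The least such `j` is where the earlier chain first returns to `C`. Strictly between there is
    -- no common vertex, yet `σ` must meet an MSI contained there.
    have hex : ∃ j, i < j ∧ j ≤ depth C ∧ vtx C' j = vtx C j :=
      ⟨depth C, hi, le_rfl, by rw [vtx_depth, ← depth_eq_depth C' C, vtx_depth]⟩
    classical
    obtain ⟨hij, hj, hv⟩ := Nat.find_spec hex
    obtain ⟨K, hK, hKI⟩ := exists_msi_subset ((h₂ _ hij hj hv).isSkipped hi hj)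
    obtain ⟨v, hvσ, hvK⟩ := h K hK
    obtain ⟨k, hik, hkj, rfl⟩ := (mem_seg hi.le hj).1 (hKI hvK)
    obtain ⟨l, -, hl, hl'⟩ := mem_interior.1 (hσ' hvσ)
    have := eq_of_vtx_eq hl.le (by rw [depth_eq_depth C' C]; omega) hl'
    subst this
    exact Nat.find_min hex hkj ⟨hik, by omega, hl'⟩

/-! ## The minimal skipped intervals -/

/-- The chain has a strict descent at its `j`-th vertex. -/
def Descent (C : MaxChain u w) (j : ℕ) : Prop := 0 < j ∧ j < depth C ∧ lab C j < lab C (j - 1)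

/-- From its vertex `i` on, the chain deletes a letter `x ≥ 2` that comes just after an equal
letter. -/
def Block (C : MaxChain u w) (i x : ℕ) : Prop :=
  2 ≤ x ∧ i + x ≤ depth C ∧ ∃ z : Fin w.parts.length, (∀ k, i ≤ k → k < i + x → lab C k = z) ∧
    emb C i z = x ∧ (left (emb C i) z).getLast? = some x

/-- The two decreases commute. Position `b` is legal already before `a` is lowered, since `b < a`
and legality only depends on the letters up to `b`. -/
theorem Descent.alt {C : MaxChain u w} {j : ℕ} (h : Descent C j) : Alt C (j - 1) (j + 1) := by
  obtain ⟨h0, hd, hlt⟩ := h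
  obtain ⟨i, rfl⟩ : ∃ i, j = i + 1 := ⟨j - 1, by omega⟩
  rw [Nat.add_sub_cancel] at hlt ⊢
  obtain ⟨a, ha, hea, hla⟩ := exists_step C (show i < depth C by omega)
  obtain ⟨b, hb, heb, hlb⟩ := exists_step C hd
  have hba : b < a := Fin.lt_def.2 (by omega)
  rw [hea] at hb heb
  refine ⟨b, ⟨?_, fun h1 => ?_⟩, by omega, ?_⟩
  · rw [← dec_of_ne (ζ := emb C i) hba.ne]; exact hb.1
  · have h1' : dec (emb C i) a b = 1 := by rw [dec_of_ne hba.ne, h1]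
    have := isRunStart_iff.1 (hb.2 h1')
    rwa [left_dec_of_le (Fin.lt_def.1 hba).le, h1', ← h1, ← isRunStart_iff] at this
  · rw [← word_emb C hd, heb]
    refine word_mono fun p => ?_
    rcases eq_or_ne p b with rfl | hp
    · rw [dec_self, dec_self, dec_of_ne hba.ne]
    · rw [dec_of_ne hp, dec_of_ne hp]; exact dec_le _ _ _

/-- With `q` the left copy of `x`, the target reads `B, x, R` around `z`. Lowering `q` first gives
`B, x - 1, x, R`, which still dominates it. -/
theorem Block.alt {C : MaxChain u w} {i x : ℕ} (h : Block C i x) : Alt C i (i + x) := by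
  obtain ⟨hx, hd, z, hz, hiz, hlast⟩ := h
  obtain ⟨B, hB⟩ := List.getLast?_eq_some_iff.1 hlast
  obtain ⟨q, hqz, hq, hqB, hq0⟩ := exists_of_left_eq_concat z.2.le hB
  have hqz' : q < z := Fin.lt_def.2 hqz
  have hjz := emb_of_lab_const (by omega) hd hz
  refine ⟨q, ⟨by omega, by omega⟩, by rw [hz i le_rfl (by omega)]; exact hqz, ?_⟩
  rw [← word_emb C hd, PWord.le_iff, letters_eq _ z, letters_eq (dec _ q) z,
    right_dec_of_le hqz.le, right_emb_eq (by omega) hd (fun k hk hk' => (hz k hk hk').le),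
    left_emb_eq (by omega) hd (fun k hk hk' => (hz k hk hk').ge), dec_of_ne hqz'.ne', hiz, hB,
    show emb C (i + x) z = 0 by omega, nonzero_singleton_zero, List.append_nil,
    nonzero_singleton (show x ≠ 0 by omega)]
  refine Dom.append (Dom.append ?_ (Dom.refl _)) (Dom.refl _)
  rw [left_eq_concat (ζ := dec (emb C i) q) hqz' (by rw [dec_self]; omega)
    (fun m hm hmz => by rw [dec_of_ne hm.ne', hq0 m hm hmz]), left_dec_of_le le_rfl, hqB]
  exact dom_append_left _ _

/-- The main step: a minimal detour that does not pass through a descent of the chain replaces a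
block. -/
theorem block_of_minimal_alt {C : MaxChain u w} {i j : ℕ} (hi : i < depth C) (hj : j ≤ depth C)
    (ha : Alt C i j) (hmin : ∀ i' j', i ≤ i' → j' ≤ j → i' < depth C → Alt C i' j' → i' = i ∧ j' = j)
    (hlab : ∀ k l, i ≤ k → k ≤ l → l < j → lab C k ≤ lab C l) :
    ∃ x, j = i + x ∧ Block C i x := by
  have hij := ha.lt hi hj
  obtain ⟨c, hc, hclt, hcle⟩ := ha
  -- The last edge before `j` has the largest label `z`, so nothing to the right of `z` changes
  -- between `i` and `j`.
  obtain ⟨z, hz, hez, hlz⟩ := exists_step C (show j - 1 < depth C by omega)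
  have hj1 : j - 1 + 1 = j := by omega
  rw [hj1] at hez
  have hlabz : ∀ k, i ≤ k → k < j → lab C k ≤ z := fun k hk hk' => by
    rw [← hlz]; exact hlab k _ hk (by omega) (by omega)
  have hcz : (c : ℕ) < z := lt_of_lt_of_le hclt (hlabz i le_rfl (by omega))
  have hcz' : c < z := Fin.lt_def.2 hcz
  set y := emb C j z with hy
  set x := emb C i z with hx
  have hyz : emb C (j - 1) z = y + 1 := by
    have := emb_succ_of_lab_eq (show j - 1 < depth C by omega) hlz
    rw [hj1] at this
    exact this.symm
  have hxy : y + 1 ≤ x := by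
    rw [← hyz]
    exact emb_le_emb C (by omega) (by omega) z
  set P := left (emb C j) z with hP
  set Q := left (dec (emb C i) c) z
  set R := right (emb C i) z
  have hR : right (emb C j) z = R := right_emb_eq (by omega) hj hlabz
  have hR' : right (emb C (j - 1)) z = R :=
    right_emb_eq (by omega) (by omega) fun k hk hk' => hlabz k hk (by omega)
  have hP' : left (emb C (j - 1)) z = P := by rw [hP, hez, left_dec_of_le le_rfl]
  have hdc : (word (dec (emb C i) c)).letters = Q ++ [x] ++ R := by
    rw [letters_eq _ z, dec_of_ne hcz'.ne', right_dec_of_le hcz.le,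
      nonzero_singleton (show emb C i z ≠ 0 by omega)]
  -- Otherwise the detour would already reach the vertex `j - 1`, against minimality.
  have hPQ : ¬ Dom P Q := fun hd => by
    have : Alt C i (j - 1) := by
      refine ⟨c, hc, hclt, ?_⟩
      rw [← word_emb C (by omega), PWord.le_iff, hdc, letters_eq _ z, hP', hR', hyz,
        nonzero_singleton (Nat.succ_ne_zero y)]
      exact (hd.append (.cons hxy .nil)).append (Dom.refl _)
    have := hmin i (j - 1) le_rfl (by omega) hi this
    omega
  rw [← word_emb C hj, PWord.le_iff, hdc, letters_eq _ z, hR] at hcle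
  have hcle' := hcle.of_append_right
  -- If a letter survived at `z`, dropping the last letter on both sides would give `Dom P Q`.
  have hy0 : y = 0 := by
    by_contra h0
    rw [nonzero_singleton h0] at hcle'
    exact hPQ hcle'.of_concat
  rw [← hy, hy0, nonzero_singleton_zero, List.append_nil] at hcle'
  obtain ⟨B, e, hBe⟩ : ∃ B e, P = B ++ [e] := by
    rcases List.eq_nil_or_concat P with h | ⟨B, e, h⟩
    · exact absurd (h ▸ .nil) hPQ
    · exact ⟨B, e, by simpa using h⟩
  rw [← hP, hBe] at hcle'
  -- Since `P` does not fit into `Q`, its last letter has to be matched with the `x` at `z`.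
  have hex : e ≤ x := by
    rcases dom_concat hcle' with h | h
    · exact h.1
    · exact absurd (hBe ▸ h) hPQ
  have he0 : e ≠ 0 := ne_zero_of_mem_left (ζ := emb C j) (i := z) (by rw [← hP, hBe]; simp)
  -- The last edge removes a `1` at `z`; legality says that the preceding letter `e` is not `1`.
  have he1 : e ≠ 1 := fun h1 => by
    have h1' : emb C (j - 1) z = 1 := by omega
    have := isRunStart_iff.1 (hz.2 h1')
    rw [hP', hBe, h1', List.getLast?_concat, h1] at this
    exact this rfl
  -- Backwards from `j`: while the value at `z` is below `x`, some earlier edge is labelled `z`, and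
  -- monotone labels bounded by `z` force the edge immediately before to be labelled `z` too.
  have key : ∀ t ≤ x, i + t ≤ j ∧ emb C (j - t) z = t ∧ ∀ k, j - t ≤ k → k < j → lab C k = z := by
    intro t
    induction t with
    | zero => exact fun _ => ⟨by omega, by rw [Nat.sub_zero, ← hy, hy0], fun k hk hk' => by omega⟩
    | succ t ih =>
      intro ht
      obtain ⟨h₁, h₂, h₃⟩ := ih (by omega)
      have hne : i ≠ j - t := fun h => by rw [← h, ← hx] at h₂; omega
      obtain ⟨k, hk, hk', hkz⟩ := exists_lab_eq (show i ≤ j - t by omega) (by omega)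
        (show emb C (j - t) z ≠ emb C i z by omega)
      have hl : lab C (j - (t + 1)) = z :=
        le_antisymm (hlabz _ (by omega) (by omega))
          (hkz ▸ hlab k _ hk (by omega) (by omega))
      refine ⟨by omega, ?_, fun l hl₁ hl₂ => ?_⟩
      · have := emb_succ_of_lab_eq (show j - (t + 1) < depth C by omega) hl
        rw [show j - (t + 1) + 1 = j - t by omega] at this
        omega
      · rcases hl₁.eq_or_lt with rfl | hl₁
        · exact hl
        · exact h₃ l (by omega) hl₂
  obtain ⟨h₁, h₂, h₃⟩ := key e hex
  have hje : j - e + e = j := by omega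
  -- The last `e` edges delete a letter `e` standing after an equal `e`. Minimality then leaves no
  -- room for further edges.
  have hb : Block C (j - e) e := by
    refine ⟨by omega, by omega, z, fun k hk hk' => h₃ k hk (by omega), h₂, ?_⟩
    rw [← left_emb_eq (show j - e ≤ j by omega) hj (fun k hk hk' => (h₃ k hk hk').ge), ← hP, hBe,
      List.getLast?_concat]
  have ha := hb.alt
  rw [hje] at ha
  have := hmin (j - e) j (by omega) le_rfl (by omega) ha
  refine ⟨e, by omega, ?_⟩
  rwa [this.1] at hb

/-- A descent strictly inside would be a skipped interval by itself, hence the whole interval.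
Without one the labels increase weakly and `block_of_minimal_alt` applies. -/
theorem descent_or_block_of_mem_msi {C : MaxChain u w} {I : Finset PWord}
    (hI : I ∈ C.msi Precedes) :
    (∃ j, Descent C j ∧ I = seg C (j - 1) (j + 1)) ∨ ∃ i x, Block C i x ∧ I = seg C i (i + x) := by
  have hm := mem_msi.1 hI
  obtain ⟨i₀, i, j, hii, hi, hj, rfl, ha⟩ := isSkipped_iff.1 hm.1
  have hij := ha.lt hi hj
  have hmin : ∀ i' j', i₀ ≤ i' → j' ≤ j → i' < depth C → Alt C i' j' → i' = i₀ ∧ j' = j := by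
    intro i' j' hi' hj' hd ha'
    have hlt := ha'.lt hd (by omega)
    have h := hm.2 (ha'.isSkipped hd (by omega))
      ((seg_subset_seg_iff hlt (by omega) (by omega) hj).2 ⟨hi', hj'⟩)
    have := (seg_subset_seg_iff (by omega) hj (by omega) (by omega)).1 h
    omega
  obtain rfl : i = i₀ := (hmin i j hii le_rfl hi ha).1
  by_cases hd : ∃ k, i < k ∧ k < j ∧ lab C k < lab C (k - 1)
  · obtain ⟨k, hk, hkj, hlt⟩ := hd
    have hk' : Descent C k := ⟨by omega, by omega, hlt⟩
    have := hmin (k - 1) (k + 1) (by omega) (by omega) (by omega) hk'.alt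
    exact .inl ⟨k, hk', by rw [this.1, this.2]⟩
  · push Not at hd
    obtain ⟨x, rfl, hb⟩ := block_of_minimal_alt hi hj ha hmin (by
      intro k l hk hkl hl
      induction l, hkl using Nat.le_induction with
      | base => exact le_rfl
      | succ l hkl ih => exact (ih (by omega)).trans (hd (l + 1) (by omega) hl))
    exact .inr ⟨i, x, hb, rfl⟩

theorem Descent.mem_msi {C : MaxChain u w} {j : ℕ} (h : Descent C j) :
    seg C (j - 1) (j + 1) ∈ C.msi Precedes := by
  have hj0 := h.1
  have hjd := h.2.1
  obtain ⟨K, hK, hKs⟩ := exists_msi_subset (h.alt.isSkipped (by omega) (by omega))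
  obtain ⟨v, hv⟩ := (CompositionPoset.mem_msi.1 hK).1.1
  have hsub : seg C (j - 1) (j + 1) ⊆ K := by
    intro v' hv'
    obtain ⟨k, h₁, h₂, rfl⟩ := (mem_seg (by omega) (by omega)).1 (hKs hv)
    obtain ⟨k', h₁', h₂', rfl⟩ := (mem_seg (by omega) (by omega)).1 hv'
    rwa [show k' = k by omega]
  rwa [← hKs.antisymm hsub]

/-- A common edge fixes the position `z`. The letters to its left do not move during a block, so the
preceding letter, which equals the block length, agrees; the value at `z` then fixes the start. -/
theorem Block.eq_of_overlap {C : MaxChain u w} {i x i' x' k : ℕ} (h : Block C i x)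
    (h' : Block C i' x') (h₁ : i ≤ k) (h₂ : k < i + x) (h₁' : i' ≤ k) (h₂' : k < i' + x') :
    i = i' ∧ x = x' := by
  obtain ⟨-, hd, z, hz, hx, hl⟩ := h
  obtain ⟨-, hd', z', hz', hx', hl'⟩ := h'
  obtain rfl : z = z' := Fin.ext (by rw [← hz k h₁ h₂, hz' k h₁' h₂'])
  have e₁ := emb_of_lab_const h₁ (by omega) fun l hl hl' => hz l hl (by omega)
  have e₂ := emb_of_lab_const h₁' (by omega) fun l hl hl' => hz' l hl (by omega)
  rw [← left_emb_eq h₁ (by omega) (fun l hl hl' => (hz l hl (by omega)).ge),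
    left_emb_eq h₁' (by omega) (fun l hl hl' => (hz' l hl (by omega)).ge), hl'] at hl
  have : x' = x := Option.some.inj hl
  omega

theorem Block.not_descent {C : MaxChain u w} {i x k : ℕ} (h : Block C i x) (h₁ : i < k)
    (h₂ : k < i + x) : ¬ Descent C k := by
  rintro ⟨-, -, hlt⟩
  obtain ⟨-, -, z, hz, -⟩ := h
  rw [hz k h₁.le h₂, hz (k - 1) (by omega) (by omega)] at hlt
  exact lt_irrefl _ hlt

/-- An MSI inside the block cannot be a descent, since the label is constant there, and any block
inside it overlaps it and so coincides with it. -/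
theorem Block.mem_msi {C : MaxChain u w} {i x : ℕ} (h : Block C i x) :
    seg C i (i + x) ∈ C.msi Precedes := by
  have hx := h.1
  have hd := h.2.1
  obtain ⟨K, hK, hKs⟩ := exists_msi_subset (h.alt.isSkipped (by omega) (by omega))
  rcases descent_or_block_of_mem_msi hK with ⟨j, hj, rfl⟩ | ⟨i', x', h', rfl⟩
  · have hj0 := hj.1
    have hjd := hj.2.1
    have := (seg_subset_seg_iff (by omega) (by omega) (by omega) (by omega)).1 hKs
    exact absurd hj (h.not_descent (by omega) (by omega))
  · have hx' := h'.1
    have hd' := h'.2.1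
    have := (seg_subset_seg_iff (by omega) (by omega) (by omega) (by omega)).1 hKs
    obtain ⟨rfl, rfl⟩ := h.eq_of_overlap h' (k := i') (by omega) (by omega) le_rfl (by omega)
    exact hK

theorem mem_msi_iff {C : MaxChain u w} {I : Finset PWord} : I ∈ C.msi Precedes ↔
    (∃ j, Descent C j ∧ I = seg C (j - 1) (j + 1)) ∨ ∃ i x, Block C i x ∧ I = seg C i (i + x) := by
  refine ⟨descent_or_block_of_mem_msi, ?_⟩
  rintro (⟨j, hj, rfl⟩ | ⟨i, x, h, rfl⟩)
  · exact hj.mem_msi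
  · exact h.mem_msi

/-- The minimal skipped intervals of a chain are pairwise disjoint. -/
theorem msi_pairwiseDisjoint (C : MaxChain u w) :
    ((C.msi Precedes : Finset (Finset PWord)) : Set (Finset PWord)).PairwiseDisjoint id := by
  intro I hI K hK hne
  rw [Function.onFun, Finset.disjoint_left]
  intro v hvI hvK
  refine hne ?_
  rcases mem_msi_iff.1 hI with ⟨j, hj, rfl⟩ | ⟨i, x, h, rfl⟩
  · have hj0 := hj.1
    have hjd := hj.2.1
    obtain ⟨k, h₁, h₂, rfl⟩ := (mem_seg (by omega) (by omega)).1 hvI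
    obtain rfl : k = j := by omega
    rcases mem_msi_iff.1 hK with ⟨j', hj', rfl⟩ | ⟨i', x', h', rfl⟩
    · have hj0' := hj'.1
      have hjd' := hj'.2.1
      have := (vtx_mem_seg (by omega) (by omega) (by omega)).1 hvK
      rw [show j' = k by omega]
    · have := h'.2.1
      have := (vtx_mem_seg (by omega) (by omega) (by omega)).1 hvK
      exact absurd hj (h'.not_descent this.1 this.2)
  · have := h.2.1
    obtain ⟨k, h₁, h₂, rfl⟩ := (mem_seg (by omega) (by omega)).1 hvI
    rcases mem_msi_iff.1 hK with ⟨j', hj', rfl⟩ | ⟨i', x', h', rfl⟩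
    · have hj0' := hj'.1
      have hjd' := hj'.2.1
      have := (vtx_mem_seg (by omega) (by omega) (by omega)).1 hvK
      obtain rfl : j' = k := by omega
      exact absurd hj' (h.not_descent h₁ h₂)
    · have := h'.2.1
      have := (vtx_mem_seg (by omega) (by omega) (by omega)).1 hvK
      obtain ⟨rfl, rfl⟩ := h.eq_of_overlap h' (k := k) (by omega) (by omega) (by omega) (by omega)
      rfl

end CompositionPoset

/-! ### Making a disjoint family of intervals disjoint -/

namespace BabsonHersh

variable {P : Type*}

theorem exists_isGreatest_of_total [PartialOrder P] {S : Finset P} (hS : S.Nonempty)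
    (h : ∀ x ∈ S, ∀ y ∈ S, x ≤ y ∨ y ≤ x) : ∃ x, IsGreatest (S : Set P) x := by
  obtain ⟨x, hx⟩ := S.exists_maximal hS
  refine ⟨x, hx.1, fun y hy => ?_⟩
  rcases h x hx.1 y hy with h' | h'
  · exact hx.2 hy h'
  · exact h'

/-- For disjoint nonempty members, cutting out `J` changes nothing and no member contains another.
-/
theorem mem_truncate_iff {F : Finset (Finset P)} {J K : Finset P}
    (hne : ∀ K ∈ F, K.Nonempty) (hd : (F : Set (Finset P)).PairwiseDisjoint id) (hJ : J ∈ F) :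
    K ∈ truncate F J ↔ K ≠ J ∧ K ∈ F := by
  classical
  have hG : ∀ K, (∃ L, (L ≠ J ∧ L ∈ F) ∧ L \ J = K) ∧ K.Nonempty ↔ K ≠ J ∧ K ∈ F := by
    intro K
    have hs : ∀ L, L ≠ J → L ∈ F → L \ J = L := fun L hL hLF =>
      Finset.sdiff_eq_self_of_disjoint (hd hLF hJ hL)
    constructor
    · rintro ⟨⟨L, ⟨hL, hLF⟩, rfl⟩, -⟩
      rw [hs L hL hLF]
      exact ⟨hL, hLF⟩
    · rintro ⟨hK, hKF⟩
      exact ⟨⟨K, ⟨hK, hKF⟩, hs K hK hKF⟩, hne K hKF⟩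
  simp only [truncate, Finset.mem_filter, Finset.mem_image, Finset.mem_erase, hG]
  refine ⟨fun h => h.1, fun h => ⟨h, h, fun L hL hLK => ?_⟩⟩
  by_contra hKL
  have hne' : L ≠ K := fun e => hKL (e ▸ le_rfl)
  obtain ⟨x, hx⟩ := hne L hL.2
  exact Finset.disjoint_left.1 (hd hL.2 h.2 hne') hx (hLK hx)

/-- A family of intervals that is disjoint from the start is not changed by the process. -/
theorem mem_disjointify_iff [PartialOrder P] {F : Finset (Finset P)} (hne : ∀ K ∈ F, K.Nonempty)
    (hd : (F : Set (Finset P)).PairwiseDisjoint id)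
    (ht : ∀ K ∈ F, ∀ L ∈ F, ∀ x ∈ K, ∀ y ∈ L, x ≤ y ∨ y ≤ x) {K : Finset P} :
    K ∈ disjointify F ↔ K ∈ F := by
  classical
  induction hn : F.card using Nat.strong_induction_on generalizing F with
  | _ n ih =>
    rw [disjointify]
    split_ifs with h
    · have hJ := h.choose_spec.1
      have hlt := card_truncate_lt hJ
      rw [List.mem_cons]
      have hm := fun L => mem_truncate_iff (K := L) hne hd hJ
      rw [ih _ (hn ▸ hlt) ?_ ?_ ?_ rfl, hm]
      · by_cases hK : K = h.choose
        · simp only [hK, true_or, true_iff]; exact hJ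
        · simp [hK]
      · exact fun L hL => hne L ((hm L).1 hL).2
      · exact hd.subset fun L hL => ((hm L).1 hL).2
      · exact fun L hL M hM => ht L ((hm L).1 hL).2 M ((hm M).1 hM).2
    -- The process stops only at the empty family: the member holding the greatest element of the
    -- union is a first member.
    · refine ⟨fun h => absurd h (List.not_mem_nil), fun hK => absurd ?_ h⟩
      obtain ⟨y, hy⟩ := hne K hK
      obtain ⟨x, hx, hx'⟩ := exists_isGreatest_of_total (S := F.biUnion id)
        ⟨y, Finset.mem_biUnion.2 ⟨K, hK, hy⟩⟩ (by
          intro x hx y hy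
          obtain ⟨L, hL, hx⟩ := Finset.mem_biUnion.1 hx
          obtain ⟨M, hM, hy⟩ := Finset.mem_biUnion.1 hy
          exact ht L hL M hM x hx y hy)
      obtain ⟨J, hJ, hxJ⟩ := Finset.mem_biUnion.1 hx
      exact ⟨J, hJ, x, hxJ, fun L hL y hy => hx' (Finset.mem_biUnion.2 ⟨L, hL, hy⟩)⟩

theorem mem_unionOf {F : Finset (Finset P)} {x : P} :
    x ∈ MaxChain.unionOf F ↔ ∃ K ∈ F, x ∈ K := by
  simp [MaxChain.unionOf]

end BabsonHersh

/-! ### Critical chains are the chains covered by their minimal skipped intervals -/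

namespace CompositionPoset

open BabsonHersh

variable {u w : PWord}

theorem msi_subset_interior {C : MaxChain u w} {I : Finset PWord} (hI : I ∈ C.msi Precedes) :
    I ⊆ C.interior :=
  IsSkipped.subset_interior (mem_msi.1 hI).1

theorem msi_nonempty {C : MaxChain u w} {I : Finset PWord} (hI : I ∈ C.msi Precedes) :
    I.Nonempty :=
  (mem_msi.1 hI).1.1

theorem interior_total {C : MaxChain u w} {x y : PWord} (hx : x ∈ C.interior)
    (hy : y ∈ C.interior) : x ≤ y ∨ y ≤ x := by
  obtain ⟨i, -, hi, rfl⟩ := mem_interior.1 hx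
  obtain ⟨j, -, hj, rfl⟩ := mem_interior.1 hy
  rcases le_total i j with h | h
  · exact .inr (vtx_le_vtx C h hj.le)
  · exact .inl (vtx_le_vtx C h hi.le)

/-- The minimal skipped intervals are the `J`-intervals. -/
theorem jIntervals_eq_msi (C : MaxChain u w) : C.jIntervals Precedes = C.msi Precedes := by
  ext K
  simp only [MaxChain.jIntervals, MaxChain.jSeq, List.mem_toFinset]
  exact mem_disjointify_iff (fun K hK => msi_nonempty hK) (msi_pairwiseDisjoint C)
    fun K hK L hL x hx y hy =>
      interior_total (msi_subset_interior hK hx) (msi_subset_interior hL hy)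

/-- Each MSI is a `J`-interval, so `σ_C` meets it in its first element. -/
theorem isNewFace_sigma (C : MaxChain u w) : C.IsNewFace Precedes (C.sigma Precedes) := by
  refine isNewFace_iff.2 ⟨fun v hv => ?_, fun I hI => ?_⟩
  · simp only [MaxChain.sigma, Finset.mem_filter] at hv
    exact hv.1
  · obtain ⟨x, hx⟩ := exists_isGreatest_of_total (msi_nonempty hI) fun x hx y hy =>
      interior_total (msi_subset_interior hI hx) (msi_subset_interior hI hy)
    refine ⟨x, ?_, hx.1⟩
    simp only [MaxChain.sigma, Finset.mem_filter]
    exact ⟨msi_subset_interior hI hx.1, I, by rwa [jIntervals_eq_msi], hx⟩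

/-- A maximal chain is critical if and only if its minimal skipped intervals cover it. -/
theorem isCritical_iff {C : MaxChain u w} :
    C.IsCritical Precedes ↔ C.CoveredBy (C.msi Precedes) := by
  classical
  constructor
  · rintro ⟨σ, hσ, hun⟩
    by_contra hcov
    have hsub : MaxChain.unionOf (C.msi Precedes) ⊆ C.interior := fun v hv => by
      obtain ⟨K, hK, hv⟩ := mem_unionOf.1 hv
      exact msi_subset_interior hK hv
    obtain ⟨x, hx⟩ := exists_isGreatest_of_total
      (S := C.interior \ MaxChain.unionOf (C.msi Precedes))
      (Finset.sdiff_nonempty.2 fun h => hcov (hsub.antisymm h))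
      fun x hx y hy => interior_total (Finset.mem_sdiff.1 hx).1 (Finset.mem_sdiff.1 hy).1
    have hxm := Finset.mem_sdiff.1 hx.1
    have htog : ∀ τ, C.IsToggle Precedes τ x := fun τ => .inl ⟨hcov, by convert hx⟩
    -- The uncovered vertex `x` lies in no MSI, so adding or removing it keeps the face new, and the
    -- toggle does not depend on the face.
    refine hun (symmDiff σ {x}) ⟨hσ, ?_, x, htog _, htog _, by congr!⟩
    rw [isNewFace_iff] at hσ ⊢
    refine ⟨fun v hv => ?_, fun I hI => ?_⟩
    · rcases Finset.mem_symmDiff.1 hv with h | h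
      · exact hσ.1 h.1
      · rw [Finset.mem_singleton.1 h.1]; exact hxm.1
    · obtain ⟨v, hv, hvI⟩ := hσ.2 I hI
      refine ⟨v, Finset.mem_symmDiff.2 (.inl ⟨hv, fun h => ?_⟩), hvI⟩
      rw [Finset.mem_singleton.1 h] at hvI
      exact hxm.2 (mem_unionOf.2 ⟨I, hI, hvI⟩)
  · intro hcov
    refine ⟨C.sigma Precedes, isNewFace_sigma C, ?_⟩
    -- For `σ_C` no rule applies: the first needs an uncovered chain, the second excludes `σ_C`, and
    -- the third needs the two families to cover differently.
    rintro τ ⟨-, -, x, h | h | h, -⟩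
    · exact h.1 hcov
    · exact h.2.2.1 rfl
    · exact h.2.1 (by rwa [jIntervals_eq_msi])

theorem coveredBy_msi_iff {C : MaxChain u w} : C.CoveredBy (C.msi Precedes) ↔
    ∀ k, 0 < k → k < depth C →
      Descent C k ∨ ∃ i x, Block C i x ∧ i < k ∧ k < i + x := by
  have hmem : ∀ k, 0 < k → k < depth C → (vtx C k ∈ MaxChain.unionOf (C.msi Precedes) ↔
      Descent C k ∨ ∃ i x, Block C i x ∧ i < k ∧ k < i + x) := by
    intro k hk hk'
    rw [mem_unionOf]
    constructor
    · rintro ⟨K, hK, hv⟩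
      rcases mem_msi_iff.1 hK with ⟨j, hj, rfl⟩ | ⟨i, x, h, rfl⟩
      · have hj0 := hj.1
        have hjd := hj.2.1
        have := (vtx_mem_seg (by omega) (by omega) hk'.le).1 hv
        obtain rfl : j = k := by omega
        exact .inl hj
      · have := h.2.1
        have := (vtx_mem_seg (by omega) (by omega) hk'.le).1 hv
        exact .inr ⟨i, x, h, this⟩
    · rintro (h | ⟨i, x, h, h₁, h₂⟩)
      · exact ⟨_, h.mem_msi, (vtx_mem_seg (by omega) (by omega) hk'.le).2 ⟨by omega, by omega⟩⟩
      · have := h.2.1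
        exact ⟨_, h.mem_msi, (vtx_mem_seg (by omega) (by omega) hk'.le).2 ⟨h₁, h₂⟩⟩
  constructor
  · intro h k hk hk'
    rw [← hmem k hk hk', h]
    exact mem_interior.2 ⟨k, hk, hk', rfl⟩
  · intro h
    refine Finset.Subset.antisymm (fun v hv => ?_) fun v hv => ?_
    · obtain ⟨K, hK, hv⟩ := mem_unionOf.1 hv
      exact msi_subset_interior hK hv
    · obtain ⟨k, hk, hk', rfl⟩ := mem_interior.1 hv
      exact (hmem k hk hk').2 (h k hk hk')

end CompositionPoset

namespace CompositionPoset

open BabsonHersh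

variable {u w : PWord}

/-! ## Weakly decreasing chains -/

theorem toSeq_ne_zero (w : PWord) (i : Fin w.parts.length) : w.toSeq i ≠ 0 :=
  (w.parts.get i).ne_zero

/-- Embeddings of `u` into `w` that satisfy a weak form of normality are reached by weakly decreasing
chains. -/
theorem exists_weaklyDecreasing {η : Fin w.parts.length → ℕ} (hle : ∀ i, η i ≤ w.toSeq i)
    (hη : ∀ i, η i = 0 → (left w.toSeq i).getLast? ≠ some 1) (hu : word η = u) :
    ∃ C : MaxChain u w, WeaklyDecreasing C ∧ emb C (depth C) = η := by
  induction hm : ∑ i, (w.toSeq i - η i) generalizing η u with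
  | zero =>
    have heq : w.toSeq = η := funext fun i => by
      have := (Finset.sum_eq_zero_iff.1 hm) i (Finset.mem_univ i)
      have := hle i
      omega
    rw [← heq, word_toSeq] at hu
    refine ⟨mkChain (fun _ => w) 0 rfl hu (by simp), ?_, ?_⟩
    · rw [weaklyDecreasing_iff, depth_mkChain]
      intro i j _ hj
      omega
    · rw [depth_mkChain, emb_zero, heq]
  | succ m ih =>
    -- The leftmost lowered position carries the smallest label, so it must be lowered last; `θ`
    -- undoes its final decrease.
    obtain ⟨p, hp, hmin⟩ : ∃ p, η p < w.toSeq p ∧ ∀ q, η q < w.toSeq q → p ≤ q := by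
      have hne : (Finset.univ.filter fun q => η q < w.toSeq q).Nonempty := by
        by_contra h
        rw [Finset.not_nonempty_iff_eq_empty, Finset.filter_eq_empty_iff] at h
        have : ∑ i, (w.toSeq i - η i) = 0 := Finset.sum_eq_zero fun i hi => by
          have := h hi
          omega
        omega
      obtain ⟨p, hp, hmin⟩ := Finset.exists_min_image _ id hne
      exact ⟨p, (Finset.mem_filter.1 hp).2, fun q hq =>
        hmin q (Finset.mem_filter.2 ⟨Finset.mem_univ q, hq⟩)⟩
    set θ := Function.update η p (η p + 1) with hθ
    have hθp : θ p = η p + 1 := Function.update_self ..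
    have hθq : ∀ q, q ≠ p → θ q = η q := fun q hq => Function.update_of_ne hq ..
    have hdec : dec θ p = η := by
      ext q
      rcases eq_or_ne q p with rfl | hq
      · rw [dec_self, hθp, Nat.add_sub_cancel]
      · rw [dec_of_ne hq, hθq q hq]
    -- Normality need not pass to `θ`, where an entry raised from `0` may have a forbidden value.
    -- The hypothesis on zeros does, because `θ` has no new zeros.
    obtain ⟨C', hwd, hend⟩ := ih (η := θ) (u := word θ)
      (fun q => by
        rcases eq_or_ne q p with rfl | hq
        · rw [hθp]; exact hp
        · rw [hθq q hq]; exact hle q)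
      (fun q h0 => by
        rcases eq_or_ne q p with rfl | hq
        · omega
        · exact hη q (hθq q hq ▸ h0)) rfl
      (by
        rw [← Finset.add_sum_erase _ _ (Finset.mem_univ p)] at hm ⊢
        rw [Finset.sum_congr rfl fun q hq => by rw [hθq q (Finset.ne_of_mem_erase hq)], hθp]
        omega)
    -- To the left of `p` nothing has been lowered, so the preceding letter is the one in `w`.
    have hlegal : Legal θ p := by
      refine ⟨by omega, fun h1 => ?_⟩
      rw [isRunStart_iff, h1]
      convert hη p (by omega) using 2
      refine left_congr fun q hq => ?_
      rw [hθq q (by rintro rfl; omega)]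
      by_contra hne
      have := hmin q (lt_of_le_of_ne (hle q) hne)
      omega
    let f : ℕ → PWord := fun k => if k ≤ depth C' then vtx C' k else u
    have hf : ∀ k, k ≤ depth C' → f k = vtx C' k := fun k hk => by simp [f, hk]
    have hfd : f (depth C' + 1) = u := by simp [f]
    have hcov : u ⋖ vtx C' (depth C') := by
      rw [vtx_depth, ← hu, ← hdec]
      exact word_dec_covBy hlegal.1
    let C : MaxChain u w := mkChain f (depth C' + 1) (by rw [hf 0 (Nat.zero_le _), vtx_zero]) hfd (by
      intro k hk
      rcases (Nat.le_of_lt_succ hk).eq_or_lt with rfl | hk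
      · rwa [hfd, hf _ le_rfl]
      · rw [hf k hk.le, hf (k + 1) hk]
        exact vtx_covBy C' hk)
    have hd : depth C = depth C' + 1 := depth_mkChain
    have hv : ∀ k ≤ depth C', vtx C k = vtx C' k := fun k hk => by
      rw [vtx_mkChain (by omega), hf k hk]
    have hemb : ∀ k ≤ depth C', emb C k = emb C' k := fun k hk =>
      emb_eq_of_vtx_eq hk (by omega) fun l hl => hv l (by omega)
    have hlast : emb C (depth C' + 1) = η := by
      have hvu : vtx C (depth C' + 1) = word (dec θ p) := by
        rw [← hd, vtx_depth, hdec, hu]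
      rw [emb_succ C (by omega), hemb _ le_rfl, hend, hvu, nextEmbedding_word_dec hlegal, hdec]
    have hlab : ∀ k < depth C', lab C k = lab C' k := fun k hk => by
      rw [lab, lab, hemb k hk.le, hemb (k + 1) hk]
    have hlablast : lab C (depth C') = p := by
      rw [lab, hlast, hemb _ le_rfl, hend, ← hdec, decreasedPosition_dec hlegal.1]
    refine ⟨C, weaklyDecreasing_iff.2 fun i j hij hj => ?_, by rw [hd, hlast]⟩
    rw [hlab i (by omega)]
    rcases (show j ≤ depth C' by omega).eq_or_lt with rfl | hj'
    · obtain ⟨q, hq, he, hl⟩ := exists_step C' hij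
      rw [hlablast, hl]
      by_contra! hqp
      have hqp' : q ≠ p := by rintro rfl; omega
      have h₁ := emb_succ_of_lab_eq hij hl
      have h₂ := emb_le_emb C' (show i + 1 ≤ depth C' from hij) le_rfl q
      have h₃ := emb_le_emb C' (Nat.zero_le i) hij.le q
      rw [hend, hθq q hqp'] at h₂
      rw [emb_zero] at h₃
      have := hmin q (by omega)
      omega
    · rw [hlab j hj']
      exact weaklyDecreasing_iff.1 hwd i j hij hj'

theorem count_lab (C : MaxChain u w) {j : ℕ} (hj : j ≤ depth C) (p : Fin w.parts.length) :
    ((List.range j).map (lab C)).count (p : ℕ) + emb C j p = w.toSeq p := by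
  induction j with
  | zero => simp [emb_zero]
  | succ j ih =>
    have := ih (by omega)
    rw [List.range_succ, List.map_append, List.count_append, List.map_singleton]
    by_cases h : lab C j = p
    · have := emb_succ_of_lab_eq hj h
      rw [h, List.count_singleton_self]
      omega
    · rw [emb_succ_of_lab_ne hj h, List.count_singleton, if_neg (by simpa using h)]
      omega

/-- The end embedding fixes how often each label occurs (`count_lab`), and a weakly decreasing list
is determined by its multiset. -/
theorem WeaklyDecreasing.eq_of_endEmbedding_eq {C C' : MaxChain u w} (h : WeaklyDecreasing C)
    (h' : WeaklyDecreasing C') (he : endEmbedding C = endEmbedding C') : C = C' := by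
  refine eq_of_labels_eq (List.Perm.eq_of_pairwise (fun a b _ _ h₁ h₂ => le_antisymm h₂ h₁) h h'
    (List.perm_iff_count.2 fun a => ?_))
  rw [endEmbedding_eq, endEmbedding_eq] at he
  rw [labels_eq, labels_eq]
  by_cases ha : a < w.parts.length
  · have h₁ := count_lab C le_rfl ⟨a, ha⟩
    have h₂ := count_lab C' le_rfl ⟨a, ha⟩
    rw [he] at h₁
    simp only at h₁ h₂
    omega
  · have : ∀ D : MaxChain u w, ((List.range (depth D)).map (lab D)).count a = 0 := by
      intro D
      refine List.count_eq_zero_of_not_mem fun hm => ?_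
      obtain ⟨k, hk, rfl⟩ := List.mem_map.1 hm
      obtain ⟨p, -, -, hl⟩ := exists_step D (List.mem_range.1 hk)
      exact ha (hl ▸ p.2)
    rw [this, this]

/-- In a weakly decreasing chain the labels equal to `p` are consecutive. -/
theorem WeaklyDecreasing.exists_block {C : MaxChain u w} (h : WeaklyDecreasing C)
    (p : Fin w.parts.length) (hp : emb C (depth C) p < w.toSeq p) :
    ∃ i, i + (w.toSeq p - emb C (depth C) p) ≤ depth C ∧ (∀ k < i, (p : ℕ) < lab C k) ∧
      (∀ k, i ≤ k → k < i + (w.toSeq p - emb C (depth C) p) → lab C k = p) ∧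
      (∀ k, i + (w.toSeq p - emb C (depth C) p) ≤ k → k < depth C → lab C k < p) := by
  rw [weaklyDecreasing_iff] at h
  have hex : ∃ i, i < depth C ∧ lab C i = p := by
    obtain ⟨k, -, hk, hk'⟩ := exists_lab_eq (C := C) (Nat.zero_le _) le_rfl (p := p)
      (by rw [emb_zero]; omega)
    exact ⟨k, hk, hk'⟩
  classical
  obtain ⟨i, hi, hip, hmin⟩ : ∃ i, i < depth C ∧ lab C i = p ∧ ∀ k < i, lab C k ≠ p :=
    ⟨Nat.find hex, (Nat.find_spec hex).1, (Nat.find_spec hex).2, fun k hk e =>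
      Nat.find_min hex hk ⟨by have := (Nat.find_spec hex).1; omega, e⟩⟩
  have hex' : ∃ j, i < j ∧ (depth C ≤ j ∨ lab C j ≠ p) := ⟨depth C, hi, .inl le_rfl⟩
  obtain ⟨j, hij, hj, hjmin⟩ : ∃ j, i < j ∧ (depth C ≤ j ∨ lab C j ≠ p) ∧
      ∀ k, i < k → k < j → k < depth C ∧ lab C k = p :=
    ⟨Nat.find hex', (Nat.find_spec hex').1, (Nat.find_spec hex').2, fun k hk hk' => by
      have := Nat.find_min hex' hk'
      push Not at this
      exact this hk⟩
  have hjd : j ≤ depth C := by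
    by_contra! hlt
    exact absurd (hjmin (depth C) hi hlt).1 (lt_irrefl _)
  have hconst : ∀ k, i ≤ k → k < j → lab C k = p := fun k hk hk' => by
    rcases hk.eq_or_lt with rfl | hk
    · exact hip
    · exact (hjmin k hk hk').2
  have hafter : ∀ k, j ≤ k → k < depth C → lab C k < p := fun k hk hk' => by
    have hjp : lab C j < p := by
      have := h i j hij (by omega)
      have := hj.resolve_left (by omega)
      omega
    rcases hk.eq_or_lt with rfl | hk
    · exact hjp
    · exact (h j k hk hk').trans_lt hjp
  have hbefore : ∀ k < i, (p : ℕ) < lab C k := fun k hk => by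
    have := h k i hk hi
    have := hmin k hk
    omega
  have e₁ := emb_eq_of_lab_ne (C := C) (Nat.zero_le i) hi.le (p := p) fun k _ hk => hmin k hk
  have e₂ := emb_of_lab_const hij.le hjd hconst
  have e₃ := emb_eq_of_lab_ne hjd le_rfl (p := p) fun k hk hk' => (hafter k hk hk').ne
  rw [emb_zero] at e₁
  have hj' : i + (w.toSeq p - emb C (depth C) p) = j := by omega
  refine ⟨i, ?_⟩
  rw [hj']
  exact ⟨hjd, hbefore, hconst, hafter⟩

/-- Only positions beyond `p` were lowered before the vertex `i`, so the letters up to `p` are still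
those of `w`. Normality forbids a zero at the first position of a run, hence an equal letter
precedes `p`. -/
theorem block_of_normal {C : MaxChain u w}
    (hn : IsNormalEmbedding u w.toSeq (emb C (depth C))) {p : Fin w.parts.length}
    (h0 : emb C (depth C) p = 0) (h2 : 2 ≤ w.toSeq p) {i : ℕ} (hd : i + w.toSeq p ≤ depth C)
    (h₁ : ∀ k < i, (p : ℕ) < lab C k) (h₂ : ∀ k, i ≤ k → k < i + w.toSeq p → lab C k = p) :
    Block C i (w.toSeq p) := by
  refine ⟨h2, hd, p, h₂, ?_, ?_⟩
  · rw [emb_eq_of_lab_ne (Nat.zero_le i) (by omega) fun k _ hk => (h₁ k hk).ne', emb_zero]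
  · rw [left_emb_eq (Nat.zero_le i) (by omega) fun k _ hk => (h₁ k hk).le, emb_zero]
    by_contra h
    exact hn.run_two_le p h2 (isRunStart_iff.2 h) h0

/-- At a vertex that is not a descent the two adjacent edges share a label `p`. Lowered at least
twice, `p` ends at `0` by normality, and its run of edges is a block around the vertex. -/
theorem WeaklyDecreasing.isCritical {C : MaxChain u w} (h : WeaklyDecreasing C)
    (hn : IsNormalEmbedding u w.toSeq (endEmbedding C)) : C.IsCritical Precedes := by
  rw [isCritical_iff, coveredBy_msi_iff]
  rw [endEmbedding_eq] at hn
  intro k hk hkd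
  by_cases hdes : lab C k < lab C (k - 1)
  · exact .inl ⟨hk, hkd, hdes⟩
  · refine .inr ?_
    obtain ⟨p, -, -, hl⟩ := exists_step C hkd
    have hl' : lab C (k - 1) = p := by
      have := weaklyDecreasing_iff.1 h (k - 1) k (by omega) hkd
      omega
    have e₁ := emb_succ_of_lab_eq hkd hl
    have e₃ := emb_le_emb C (Nat.zero_le k) hkd.le p
    have e₄ := emb_le_emb C (show k + 1 ≤ depth C from hkd) le_rfl p
    rw [emb_zero] at e₃
    obtain ⟨i, hd, h₁, h₂, h₃⟩ := h.exists_block p (by omega)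
    have hki : i ≤ k - 1 := by
      by_contra! hlt
      have := h₁ _ hlt
      omega
    have hki' : k < i + (w.toSeq p - emb C (depth C) p) := by
      by_contra! hle
      have := h₃ k hle hkd
      omega
    have h0 : emb C (depth C) p = 0 := by
      have := hn.value p
      omega
    rw [h0, Nat.sub_zero] at hd h₂ hki'
    exact ⟨i, w.toSeq p, block_of_normal hn h0 (by omega) hd h₁ h₂, by omega, hki'⟩

theorem IsCritical.weaklyDecreasing {C : MaxChain u w} (h : C.IsCritical Precedes) :
    WeaklyDecreasing C := by
  rw [isCritical_iff, coveredBy_msi_iff] at h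
  rw [weaklyDecreasing_iff]
  intro i j hij hj
  induction j, hij using Nat.le_induction with
  | base =>
    rcases h (i + 1) (by omega) hj with h | ⟨l, x, ⟨-, -, z, hz, -⟩, h₁, h₂⟩
    · exact h.2.2.le
    · rw [hz (i + 1) (by omega) h₂, hz i (by omega) (by omega)]
  | succ j hij ih =>
    refine le_trans ?_ (ih (by omega))
    rcases h (j + 1) (by omega) hj with h | ⟨l, x, ⟨-, -, z, hz, -⟩, h₁, h₂⟩
    · exact h.2.2.le
    · rw [hz (j + 1) (by omega) h₂, hz j (by omega) (by omega)]

theorem IsCritical.isNormalEmbedding {C : MaxChain u w} (h : C.IsCritical Precedes) :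
    IsNormalEmbedding u w.toSeq (endEmbedding C) := by
  have hwd := IsCritical.weaklyDecreasing h
  rw [isCritical_iff, coveredBy_msi_iff] at h
  rw [endEmbedding_eq]
  have hle : ∀ p, emb C (depth C) p ≤ w.toSeq p := emb_le_emb C (Nat.zero_le _) le_rfl
  -- A position lowered once satisfies the run condition by legality of its edge. If it is lowered
  -- more often, the vertex after its first edge is no descent, so it lies in a block; that block
  -- starts with this edge and deletes the whole letter.
  have key : ∀ p, emb C (depth C) p < w.toSeq p →
      (emb C (depth C) p + 1 = w.toSeq p ∧ (w.toSeq p = 1 → IsRunStart w.toSeq p)) ∨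
      (emb C (depth C) p = 0 ∧ 2 ≤ w.toSeq p ∧ ¬ IsRunStart w.toSeq p) := by
    intro p hp
    obtain ⟨i, hd, h₁, h₂, h₃⟩ := hwd.exists_block p hp
    have e₁ : emb C i p = w.toSeq p :=
      emb_eq_of_lab_ne (Nat.zero_le i) (by omega) fun k _ hk => (h₁ k hk).ne'
    have e₂ : left (emb C i) p = left w.toSeq p :=
      left_emb_eq (Nat.zero_le i) (by omega) fun k _ hk => (h₁ k hk).le
    by_cases hm : w.toSeq p - emb C (depth C) p = 1
    · refine .inl ⟨by omega, fun h1 => ?_⟩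
      obtain ⟨q, hq, -, hl⟩ := exists_step C (show i < depth C by omega)
      obtain rfl : q = p := Fin.ext (by rw [← hl, h₂ i le_rfl (by omega)])
      have := hq.2 (by omega)
      rwa [isRunStart_iff, e₁, e₂, ← isRunStart_iff] at this
    · refine .inr ?_
      have hi1 := h₂ (i + 1) (by omega) (by omega)
      rcases h (i + 1) (by omega) (by omega) with hdes | ⟨s, x, hb, hs₁, hs₂⟩
      · have := hdes.2.2
        rw [Nat.add_sub_cancel, hi1, h₂ i le_rfl (by omega)] at this
        omega
      · obtain ⟨hx, hxd, z, hz, hsz, hlast⟩ := hb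
        obtain rfl : z = p := Fin.ext (by rw [← hz _ hs₁.le hs₂, hi1])
        obtain rfl : s = i := by
          by_contra hne
          have := h₁ s (by omega)
          have := hz s le_rfl (by omega)
          omega
        have e₃ := emb_of_lab_const (by omega) hxd hz
        have e₄ := emb_le_emb C hxd le_rfl z
        refine ⟨by omega, by omega, fun hr => ?_⟩
        rw [isRunStart_iff, ← e₂, hlast] at hr
        exact hr (by rw [← e₁, hsz])
  refine ⟨⟨isExpansion_iff.2 (by rw [word_emb C le_rfl, vtx_depth]), hle⟩, fun p => ?_,
    fun p h1 hr h0 => ?_, fun p h2 hr h0 => ?_⟩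
  · rcases (hle p).eq_or_lt with h | h
    · exact .inl h
    · rcases key p h with h | h
      · exact .inr (.inl h.1)
      · exact .inr (.inr h.1)
  · rcases key p (by omega) with h | h
    · exact hr (h.2 h1)
    · omega
  · rcases key p (by omega) with h | h
    · omega
    · exact h.2.2 hr

theorem IsNormalEmbedding.exists_chain {η : Fin w.parts.length → ℕ}
    (h : IsNormalEmbedding u w.toSeq η) :
    ∃ C : MaxChain u w, WeaklyDecreasing C ∧ endEmbedding C = η := by
  -- No zero comes just after a `1` of `w`: a `1` there is not a run start, and a larger letter
  -- there is one, so normality keeps either nonzero.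
  obtain ⟨C, hwd, he⟩ := exists_weaklyDecreasing h.isEmbedding.2 (fun i h0 hl => by
    by_cases h1 : w.toSeq i = 1
    · exact h.run_one i h1 (by rw [isRunStart_iff, h1, not_not]; exact hl) h0
    · have := toSeq_ne_zero w i
      refine h.run_two_le i (by omega) ?_ h0
      rw [isRunStart_iff, hl]
      exact fun e => h1 (Option.some.inj e).symm) (isExpansion_iff.1 h.isEmbedding.1)
  exact ⟨C, hwd, by rw [endEmbedding_eq, he]⟩

/-! ## The number of minimal skipped intervals -/

theorem seg_inj {C : MaxChain u w} {i j i' j' : ℕ} (hij : i + 1 < j) (hj : j ≤ depth C)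
    (hij' : i' + 1 < j') (hj' : j' ≤ depth C) (h : seg C i j = seg C i' j') : i = i' ∧ j = j' := by
  have h₁ := (seg_subset_seg_iff hij hj (by omega) hj').1 h.subset
  have h₂ := (seg_subset_seg_iff hij' hj' (by omega) hj).1 h.superset
  omega

/-- The lowered positions `L` number `d + D`. Each has one run of edges, starting at `f p`; every
start but the top one is a descent, and the positions in `D` give the blocks. -/
theorem card_msi {C : MaxChain u w} (huw : u < w) (h : C.IsCritical Precedes) :
    (C.msi Precedes).card + 1 =
      defect w (endEmbedding C) + 2 * bigDefect w (endEmbedding C) := by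
  classical
  have hwd := IsCritical.weaklyDecreasing h
  have hn := IsCritical.isNormalEmbedding h
  rw [endEmbedding_eq] at hn ⊢
  set η := emb C (depth C) with hη
  have hd0 : 0 < depth C := by
    have := depth_eq C
    have := PWord.rank_strictMono huw
    omega
  have hlabel : ∀ k < depth C, ∃ p : Fin w.parts.length, lab C k = p ∧ η p < w.toSeq p := by
    intro k hk
    obtain ⟨p, -, -, hl⟩ := exists_step C hk
    have e₁ := emb_succ_of_lab_eq hk hl
    have e₂ := emb_le_emb C (Nat.zero_le k) hk.le p
    have e₃ := emb_le_emb C (show k + 1 ≤ depth C from hk) le_rfl p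
    rw [emb_zero] at e₂
    rw [← hη] at e₃
    exact ⟨p, hl, by omega⟩
  have hex : ∀ p : Fin w.parts.length, ∃ i, η p < w.toSeq p →
      i + (w.toSeq p - η p) ≤ depth C ∧ (∀ k < i, (p : ℕ) < lab C k) ∧
      (∀ k, i ≤ k → k < i + (w.toSeq p - η p) → lab C k = p) ∧
      (∀ k, i + (w.toSeq p - η p) ≤ k → k < depth C → lab C k < p) := fun p => by
    by_cases hp : η p < w.toSeq p
    · obtain ⟨i, hi⟩ := hwd.exists_block p hp
      exact ⟨i, fun _ => hi⟩
    -- A dummy value, never used for a position that is not lowered.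
    · exact ⟨0, fun h => absurd h hp⟩
  choose f hf using hex
  have hfle : ∀ p, η p < w.toSeq p → ∀ k < depth C, lab C k = p →
      f p ≤ k ∧ k < f p + (w.toSeq p - η p) := fun p hp k hk hl => by
    obtain ⟨_, h₁, _, h₃⟩ := hf p hp
    constructor
    · by_contra! hlt
      have := h₁ k hlt
      omega
    · by_contra! hle
      have := h₃ k hle hk
      omega
  have hfp : ∀ p, η p < w.toSeq p → f p < depth C ∧ lab C (f p) = p := fun p hp => by
    obtain ⟨h₀, _, h₂, _⟩ := hf p hp
    exact ⟨by omega, h₂ _ le_rfl (by omega)⟩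
  have hfinj : ∀ p q, η p < w.toSeq p → η q < w.toSeq q → f p = f q → p = q := by
    intro p q hp hq e
    exact Fin.ext (by rw [← (hfp p hp).2, ← (hfp q hq).2, e])
  -- The run of `p₀` starts at the top vertex, which is not interior; this accounts for the `- 1`.
  -- The first edge exists because `u < w`.
  obtain ⟨p₀, hp₀, hp₀'⟩ := hlabel 0 hd0
  have hf₀ : f p₀ = 0 := Nat.le_zero.1 (hfle p₀ hp₀' 0 hd0 hp₀).1
  set L := Finset.univ.filter fun p => η p < w.toSeq p with hL
  set D := Finset.univ.filter fun p => η p = 0 ∧ 2 ≤ w.toSeq p with hD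
  have memL : ∀ p, p ∈ L ↔ η p < w.toSeq p := fun p => by simp [hL]
  have memD : ∀ p, p ∈ D ↔ η p = 0 ∧ 2 ≤ w.toSeq p := fun p => by simp [hD]
  have hdesc : ∀ p ∈ L.erase p₀, Descent C (f p) := fun p hp => by
    obtain ⟨hne, hp⟩ := Finset.mem_erase.1 hp
    rw [memL] at hp
    have hpos : 0 < f p := Nat.pos_of_ne_zero fun e => hne (hfinj p p₀ hp hp₀' (by rw [e, hf₀]))
    refine ⟨hpos, (hfp p hp).1, ?_⟩
    rw [(hfp p hp).2]
    exact (hf p hp).2.1 _ (by omega)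
  have hblock : ∀ p ∈ D, Block C (f p) (w.toSeq p) := fun p hp => by
    obtain ⟨h0, h2⟩ := (memD p).1 hp
    obtain ⟨h₀, h₁, h₂, -⟩ := hf p (by omega)
    rw [h0, Nat.sub_zero] at h₀ h₂
    exact block_of_normal hn h0 h2 h₀ h₁ h₂
  have hmsi : C.msi Precedes = (L.erase p₀).image (fun p => seg C (f p - 1) (f p + 1)) ∪
      D.image (fun p => seg C (f p) (f p + w.toSeq p)) := by
    ext I
    rw [Finset.mem_union, Finset.mem_image, Finset.mem_image, mem_msi_iff]
    refine or_congr ⟨?_, ?_⟩ ⟨?_, ?_⟩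
    · rintro ⟨j, ⟨hj0, hjd, hlt⟩, rfl⟩
      obtain ⟨p, hl, hp⟩ := hlabel j hjd
      have hle := hfle p hp j hjd hl
      have hfj : f p = j := by
        by_contra hne
        have := (hf p hp).2.2.1 (j - 1) (by omega) (by omega)
        omega
      refine ⟨p, Finset.mem_erase.2 ⟨?_, (memL p).2 hp⟩, by rw [hfj]⟩
      rintro rfl
      omega
    · rintro ⟨p, hp, rfl⟩
      exact ⟨f p, hdesc p hp, rfl⟩
    · rintro ⟨i, x, hb, rfl⟩
      have hb' := hb
      obtain ⟨hx, hxd, z, hz, hiz, -⟩ := hb'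
      have e₁ := emb_of_lab_const (by omega) hxd hz
      have e₂ := emb_le_emb C hxd le_rfl z
      have e₃ := emb_le_emb C (Nat.zero_le i) (by omega) z
      rw [emb_zero] at e₃
      rw [← hη] at e₂
      have hzD : z ∈ D := (memD z).2 ⟨by omega, by omega⟩
      have hz0 := ((memD z).1 hzD).1
      have hle := hfle z (by omega) i (by omega) (hz i le_rfl (by omega))
      obtain ⟨rfl, rfl⟩ := (hblock z hzD).eq_of_overlap hb (k := i) hle.1 (by omega) le_rfl (by omega)
      exact ⟨z, hzD, rfl⟩
    · rintro ⟨p, hp, rfl⟩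
      exact ⟨f p, _, hblock p hp, rfl⟩
  have hdisj : Disjoint ((L.erase p₀).image (fun p => seg C (f p - 1) (f p + 1)))
      (D.image (fun p => seg C (f p) (f p + w.toSeq p))) := by
    rw [Finset.disjoint_left]
    rintro I hI hI'
    obtain ⟨p, hp, rfl⟩ := Finset.mem_image.1 hI
    obtain ⟨q, hq, he⟩ := Finset.mem_image.1 hI'
    have hb := hblock q hq
    have hde := hdesc p hp
    have h0 := hde.1
    have hd := hde.2.1
    have h2 := hb.1
    have hd' := hb.2.1
    have := seg_inj (by omega) hd' (by omega) (by omega) he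
    exact hb.not_descent (by omega) (by omega) hde
  have hcard : L.card = defect w η + bigDefect w η := by
    rw [defect, bigDefect, ← Finset.card_union_of_disjoint]
    · congr 1
      ext p
      have := hn.value p
      have := toSeq_ne_zero w p
      simp only [hL, Finset.mem_union, Finset.mem_filter, Finset.mem_univ, true_and]
      omega
    · rw [Finset.disjoint_filter]
      intro p _ _
      omega
  have hDcard : D.card = bigDefect w η := rfl
  rw [hmsi, Finset.card_union_of_disjoint hdisj, Finset.card_image_of_injOn, Finset.card_image_of_injOn]
  · have := Finset.card_erase_add_one ((memL p₀).2 hp₀')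
    omega
  · intro p hp q hq he
    have h₁ := hblock p hp
    have h₂ := hblock q hq
    have hp' := (memD p).1 hp
    have hq' := (memD q).1 hq
    have := h₁.2.1
    have := h₂.2.1
    exact hfinj p q (by omega) (by omega) (seg_inj (by omega) h₁.2.1 (by omega) h₂.2.1 he).1
  · intro p hp q hq he
    obtain ⟨h0, hd, -⟩ := hdesc p hp
    obtain ⟨h0', hd', -⟩ := hdesc q hq
    have := seg_inj (by omega) (by omega) (by omega) (by omega) he
    exact hfinj p q ((memL p).1 (Finset.mem_of_mem_erase hp))
      ((memL q).1 (Finset.mem_of_mem_erase hq)) (by omega)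

end CompositionPoset

/-! ### The theorem -/

theorem theorem5p4 (u w : CompositionPoset.PWord) (huw : u < w) :
    (∀ η : Fin w.parts.length → ℕ, CompositionPoset.IsNormalEmbedding u w.toSeq η →
      ∃! C : BabsonHersh.MaxChain u w,
        CompositionPoset.WeaklyDecreasing C ∧ CompositionPoset.endEmbedding C = η) ∧
    (∃ Φ : {η : Fin w.parts.length → ℕ // CompositionPoset.IsNormalEmbedding u w.toSeq η} ≃
        {C : BabsonHersh.MaxChain u w // C.IsCritical CompositionPoset.Precedes},
      ∀ η, CompositionPoset.WeaklyDecreasing (Φ η).1 ∧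
        CompositionPoset.endEmbedding (Φ η).1 = η.1) ∧
    (∀ C : BabsonHersh.MaxChain u w, C.IsCritical CompositionPoset.Precedes →
      C.msi CompositionPoset.Precedes = C.jIntervals CompositionPoset.Precedes ∧
      ((C.msi CompositionPoset.Precedes).card : ℤ) =
        (CompositionPoset.defect w (CompositionPoset.endEmbedding C) : ℤ) +
          2 * (CompositionPoset.bigDefect w (CompositionPoset.endEmbedding C) : ℤ) - 1) := by
  refine ⟨fun η hη => ?_, ?_, fun C hC => ⟨(CompositionPoset.jIntervals_eq_msi C).symm, ?_⟩⟩
  · obtain ⟨C, hwd, rfl⟩ := hη.exists_chain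
    exact ⟨C, ⟨hwd, rfl⟩, fun C' h => h.1.eq_of_endEmbedding_eq hwd h.2⟩
  · choose F hF hF' using fun η : {η : Fin w.parts.length → ℕ //
      CompositionPoset.IsNormalEmbedding u w.toSeq η} => η.2.exists_chain
    refine ⟨Equiv.ofBijective (fun η => ⟨F η, (hF η).isCritical (by rw [hF' η]; exact η.2)⟩)
      ⟨fun η θ h => ?_, fun C => ?_⟩, fun η => ⟨hF η, hF' η⟩⟩
    · have h' : F η = F θ := congrArg Subtype.val h
      exact Subtype.ext (by rw [← hF' η, ← hF' θ, h'])
    -- A critical chain is weakly decreasing and ends at a normal embedding, so by uniqueness it is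
    -- the chain chosen for that embedding.
    · refine ⟨⟨_, CompositionPoset.IsCritical.isNormalEmbedding C.2⟩, Subtype.ext ?_⟩
      exact (hF _).eq_of_endEmbedding_eq (CompositionPoset.IsCritical.weaklyDecreasing C.2) (hF' _)
  · have := CompositionPoset.card_msi huw hC
    omega
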